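/- Let $d\ge 1$, let $\Omega\subset\mathbb R^d$ be a nonempty bounded convex open set with smooth boundary, let $T>0$ and $0<\alpha<1$, and write $(\cdot,\cdot)$, $\|\cdot\|$ for the inner product and norm of $L^2(\Omega)$ and $\|v\|_1=(\|v\|^2+\|\nabla v\|^2)^{1/2}$. Let $b_2$ (with values in the symmetric positive definite $d\times d$ matrices), $b_1$ (with values in $\mathbb R^d$) and $b_0$ (real valued) be smooth on $\bar\Omega\times[0,T]\times[0,T]$, and put $$B(t,s,u,v)=(b_2(\cdot,t,s)\nabla u,\nabla v)-(b_1(\cdot,t,s)u,\nabla v)+(b_0(\cdot,t,s)u,v).$$ *Data.* (A1) $u_0\in H^2(\Omega)\cap H^1_0(\Omega)$ and $f\in L^\infty(0,T;L^2(\Omega))$, where $f$ is a function on $[0,T]$ with well-defined values $f^n:=f(t_n)$. (A2) $M:[0,\infty)\to\mathbb R$ is Lipschitz continuous with constant $L_M$, $M(s)\ge m_0>0$ for all $s>0$, and $m_0-4L_MK^2>0$, where $K=\|u_0\|_1+\|f\|_{L^\infty(0,T;L^2(\Omega))}$. *Space discretization.* Let $\mathbb T_h$ be a conforming triangulation by finitely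 many $d$-simplices, whose union $\Omega_h$ is contained in $\bar\Omega$ and whose vertices on $\partial\Omega_h$ lie on $\partial\Omega$. Let it be shape regular with constant $\sigma$ (each simplex $S$ contains a ball of radius $r>0$ with $\operatorname{diam}S\le\sigma r$) and quasi-uniform with constant $\kappa$ ($\operatorname{diam}S\le\kappa\operatorname{diam}S'$ for any two simplices $S$, $S'$). Let $X_h$ be the space of all $v\in H^1_0(\Omega)$ that are affine on each simplex and vanish outside $\Omega_h$. Let $R_hu_0\in X_h$ be the Ritz projection of $u_0$, defined by $(\nabla R_hu_0,\nabla v)=(\nabla u_0,\nabla v)$ for all $v\in X_h$, and let $f_h^n\in X_h$ be the $L^2$-projection of $f^n$, defined by $(f_h^n,v)=(f^n,v)$ for all $v\in X_h$. *Time discretization.* Let $N\ge1$, $\delta\ge1$, $t_n=T(n/N)^\delta$ for $0\le n\le N$, $\tau_n=t_n-t_{n-1}$, and $$\mathbb D_t^\alpha u^n=\sum_{j=1}^nk_{n,j}(u^j-u^{j-1}),\qquad k_{n,j}=\frac{\tau_j^{-1}}{\Gamma(1-\alpha)}\int_{t_{j-1}}^{t_j}(t_n-s)^{-\alpha}\,ds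 .$$ *Scheme.* A numerical solution is a sequence $u_h^0=R_hu_0$, $u_h^1,\dots,u_h^N\in X_h$ such that, for all $v_h\in X_h$, $$(\mathbb D_t^\alpha u_h^1,v_h)+M(\|\nabla u_h^1\|^2)(\nabla u_h^1,\nabla v_h)=(f_h^1,v_h)+\tau_1B(t_1,t_1,u_h^1,v_h)$$ and, for $2\le n\le N$, $$(\mathbb D_t^\alpha u_h^n,v_h)+M(\|\nabla\tilde u_h^{n-1}\|^2)(\nabla u_h^n,\nabla v_h)=(f_h^n,v_h)+\sum_{j=1}^{n-1}\tau_{j+1}\bar B(t_n,t_j,u_h^j,v_h),$$ where $\tilde u_h^{n-1}=\bigl(1+\frac{\tau_n}{\tau_{n-1}}\bigr)u_h^{n-1}-\frac{\tau_n}{\tau_{n-1}}u_h^{n-2}$, and where $\bar B(t_n,t_j,u_h^j,v_h)$ equals $\frac12[B(t_n,t_j,u_h^j,v_h)+B(t_n,t_{j+1},u_h^{j+1},v_h)]$ for $1\le j\le n-2$ and $B(t_n,t_{n-1},u_h^{n-1},v_h)$ for $j=n-1$. **Theorem.** There are constants $C>0$ and $\tau_*>0$, depending only on $\Omega$, $T$,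 $\alpha$, $b_0,b_1,b_2$, $m_0$, $\sigma$ and $\kappa$, such that, for all $u_0$, $f$, $M$ satisfying (A1)–(A2), all such triangulations, and all $N\ge1$, $\delta\ge1$ with first time step $\tau_1\le\tau_*$, every numerical solution satisfies $$\max_{1\le n\le N}\|\nabla u_h^n\|\le C\Bigl(\|\nabla u_0\|+\max_{1\le n\le N}\|f^n\|\Bigr).$$ -/

import Mathlib

open MeasureTheory Set Topology
open scoped ContDiff Distributions NNReal

noncomputable section

namespace Kirchhoff

/-- The Euclidean space `ℝᵈ`. -/
abbrev Space (d : ℕ) : Type := EuclideanSpace ℝ (Fin d)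

/-! ### Function spaces on a domain -/

/-- `L²(Ω)`. -/
abbrev L2 {d : ℕ} (Ω : TopologicalSpace.Opens (Space d)) : Type :=
  Lp ℝ 2 (volume.restrict (Ω : Set (Space d)))

/-- `L²(Ω; ℝᵈ)`. -/
abbrev L2Vec {d : ℕ} (Ω : TopologicalSpace.Opens (Space d)) : Type :=
  Lp (Space d) 2 (volume.restrict (Ω : Set (Space d)))

/-- The Hilbert space `L²(Ω) × L²(Ω; ℝᵈ)` with norm `(‖u‖² + ‖g‖²)^{1/2}`. A Sobolev function `u`
is represented by the pair `(u, ∇u)`, so that the norm of the pair is the `H¹(Ω)` norm of `u`. -/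
abbrev H1Pair {d : ℕ} (Ω : TopologicalSpace.Opens (Space d)) : Type :=
  WithLp 2 (L2 Ω × L2Vec Ω)

/-- The subspace of all pairs `(φ, ∇φ)` with `φ ∈ C_c^∞(Ω)`. -/
def testPairs {d : ℕ} (Ω : TopologicalSpace.Opens (Space d)) : Submodule ℝ (H1Pair Ω) where
  carrier := {p | ∃ φ : 𝓓(Ω, ℝ),
    p.fst =ᵐ[volume.restrict (Ω : Set (Space d))] (fun x => φ x) ∧
    p.snd =ᵐ[volume.restrict (Ω : Set (Space d))] (fun x => gradient φ x)}
  zero_mem' := by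
    refine ⟨0, ?_, ?_⟩
    · filter_upwards [Lp.coeFn_zero ℝ 2 (volume.restrict (Ω : Set (Space d)))] with x hx
      simpa using hx
    · filter_upwards [Lp.coeFn_zero (Space d) 2 (volume.restrict (Ω : Set (Space d)))] with x hx
      have h : ((0 : 𝓓(Ω, ℝ)) : Space d → ℝ) = fun _ => 0 := by ext; simp
      rw [h, gradient_fun_const]
      simpa using hx
  add_mem' := by
    rintro p q ⟨φ, hφ, hφ'⟩ ⟨ψ, hψ, hψ'⟩
    refine ⟨φ + ψ, ?_, ?_⟩
    · filter_upwards [Lp.coeFn_add p.fst q.fst, hφ, hψ] with x hx h1 h2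
      simp only [WithLp.add_fst, hx, Pi.add_apply, h1, h2, FunLike.coe_add, Pi.add_apply]
    · filter_upwards [Lp.coeFn_add p.snd q.snd, hφ', hψ'] with x hx h1 h2
      have e : ((φ + ψ : 𝓓(Ω, ℝ)) : Space d → ℝ) = (φ : Space d → ℝ) + ψ := by ext; simp
      have d1 : DifferentiableAt ℝ (φ : Space d → ℝ) x :=
        (TestFunctionClass.map_contDiff φ).differentiable (by simp) x
      have d2 : DifferentiableAt ℝ (ψ : Space d → ℝ) x :=
        (TestFunctionClass.map_contDiff ψ).differentiable (by simp) x
      simp only [WithLp.add_snd, hx, Pi.add_apply, h1, h2]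
      rw [e, gradient, gradient, gradient, fderiv_add d1 d2, map_add]
  smul_mem' := by
    rintro c p ⟨φ, hφ, hφ'⟩
    refine ⟨c • φ, ?_, ?_⟩
    · filter_upwards [Lp.coeFn_smul c p.fst, hφ] with x hx h1
      simp only [WithLp.smul_fst, hx, Pi.smul_apply, h1, FunLike.coe_smul]
    · filter_upwards [Lp.coeFn_smul c p.snd, hφ'] with x hx h1
      have e : ((c • φ : 𝓓(Ω, ℝ)) : Space d → ℝ) = c • (φ : Space d → ℝ) := by ext; simp
      have d1 : DifferentiableAt ℝ (φ : Space d → ℝ) x :=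
        (TestFunctionClass.map_contDiff φ).differentiable (by simp) x
      simp only [WithLp.smul_snd, hx, Pi.smul_apply, h1]
      rw [e, gradient, gradient, fderiv_const_smul d1]
      simp

/-- `H¹₀(Ω)`: the closure of `C_c^∞(Ω)` in the `H¹(Ω)` norm. An element is the pair
`(u, ∇u)`. -/
def H10 {d : ℕ} (Ω : TopologicalSpace.Opens (Space d)) : Submodule ℝ (H1Pair Ω) :=
  (testPairs Ω).topologicalClosure

/-- `g` is the weak gradient of `u` on `Ω`. -/
def HasWeakGradient {d : ℕ} (Ω : TopologicalSpace.Opens (Space d))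
    (u : Space d → ℝ) (g : Space d → Space d) : Prop :=
  ∀ (φ : 𝓓(Ω, ℝ)) (i : Fin d),
    ∫ x in (Ω : Set (Space d)), u x * fderiv ℝ φ x (EuclideanSpace.single i 1)
      = - ∫ x in (Ω : Set (Space d)), g x i * φ x

/-- `u ∈ H²(Ω)`: the pair is `(u, ∇u)`, and each first derivative has its weak gradient in
`L²(Ω; ℝᵈ)`. -/
def MemH2 {d : ℕ} (Ω : TopologicalSpace.Opens (Space d)) (u : H1Pair Ω) : Prop :=
  HasWeakGradient Ω u.fst u.snd ∧
    ∀ i : Fin d, ∃ w : L2Vec Ω, HasWeakGradient Ω (fun x => u.snd x i) w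

/-- `Ω` has a smooth boundary: near each boundary point, `Ω` is the sublevel set `{ρ < 0}` of a
smooth function `ρ` with nonvanishing derivative. -/
def HasSmoothBoundary {d : ℕ} (Ω : Set (Space d)) : Prop :=
  ∀ x ∈ frontier Ω, ∃ U ∈ 𝓝 x, ∃ ρ : Space d → ℝ,
    ContDiff ℝ ∞ ρ ∧ fderiv ℝ ρ x ≠ 0 ∧ Ω ∩ U = {y ∈ U | ρ y < 0}

/-! ### Triangulations and the finite element space -/

/-- A (conforming) triangulation of `Ω`: a finite nonempty simplicial complex all of whose maximal
simplices are `d`-simplices, whose union `Ω_h` is contained in `Ω̄`, and whose boundary vertices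
lie on `∂Ω`. -/
structure IsTriangulation {d : ℕ} (Ω : Set (Space d))
    (𝒯 : Geometry.SimplicialComplex ℝ (Space d)) : Prop where
  finite : 𝒯.faces.Finite
  nonempty : 𝒯.faces.Nonempty
  pure : ∀ s ∈ 𝒯.faces, ∃ S ∈ 𝒯.faces, s ⊆ S ∧ S.card = d + 1
  space_subset : 𝒯.space ⊆ closure Ω
  boundary_vertices : ∀ x ∈ 𝒯.vertices, x ∈ frontier 𝒯.space → x ∈ frontier Ω

/-- Every element (`d`-simplex) `S` contains a ball of radius `r` with `diam S ≤ σ r`. -/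
def IsShapeRegular {d : ℕ} (σ : ℝ) (𝒯 : Geometry.SimplicialComplex ℝ (Space d)) : Prop :=
  ∀ S ∈ 𝒯.faces, S.card = d + 1 →
    ∃ (c : Space d) (r : ℝ), 0 < r ∧
      Metric.closedBall c r ⊆ convexHull ℝ (S : Set (Space d)) ∧
      Metric.diam (convexHull ℝ (S : Set (Space d))) ≤ σ * r

/-- The diameters of any two elements are comparable, with constant `κ`. -/
def IsQuasiUniform {d : ℕ} (κ : ℝ) (𝒯 : Geometry.SimplicialComplex ℝ (Space d)) : Prop :=
  ∀ S ∈ 𝒯.faces, S.card = d + 1 → ∀ S' ∈ 𝒯.faces, S'.card = d + 1 →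
    Metric.diam (convexHull ℝ (S : Set (Space d))) ≤
      κ * Metric.diam (convexHull ℝ (S' : Set (Space d)))

/-- The finite element space `X_h` of all `v ∈ H¹₀(Ω)` that are affine on every element and vanish
outside the union `Ω_h` of the elements. -/
def femSpace {d : ℕ} (Ω : TopologicalSpace.Opens (Space d))
    (𝒯 : Geometry.SimplicialComplex ℝ (Space d)) : Submodule ℝ (H1Pair Ω) where
  carrier := {v | v ∈ H10 Ω ∧
    (∀ S ∈ 𝒯.faces, S.card = d + 1 → ∃ a : Space d →ᵃ[ℝ] ℝ,
      ∀ᵐ x ∂(volume.restrict (Ω : Set (Space d))),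
        x ∈ convexHull ℝ (S : Set (Space d)) → v.fst x = a x) ∧
    ∀ᵐ x ∂(volume.restrict (Ω : Set (Space d))), x ∉ 𝒯.space → v.fst x = 0}
  zero_mem' := by
    have h0 := Lp.coeFn_zero ℝ 2 (volume.restrict (Ω : Set (Space d)))
    refine ⟨Submodule.zero_mem _, fun S _ _ => ⟨0, ?_⟩, ?_⟩
    · filter_upwards [h0] with x hx _
      simpa using hx
    · filter_upwards [h0] with x hx _
      simpa using hx
  add_mem' := by
    rintro u v ⟨hu, hu1, hu2⟩ ⟨hv, hv1, hv2⟩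
    refine ⟨Submodule.add_mem _ hu hv, fun S hS hc => ?_, ?_⟩
    · obtain ⟨a, ha⟩ := hu1 S hS hc
      obtain ⟨b, hb⟩ := hv1 S hS hc
      refine ⟨a + b, ?_⟩
      filter_upwards [Lp.coeFn_add u.fst v.fst, ha, hb] with x hx h1 h2 hxS
      rw [WithLp.add_fst, hx]
      simp [h1 hxS, h2 hxS]
    · filter_upwards [Lp.coeFn_add u.fst v.fst, hu2, hv2] with x hx h1 h2 hxS
      rw [WithLp.add_fst, hx]
      simp [h1 hxS, h2 hxS]
  smul_mem' := by
    rintro c u ⟨hu, hu1, hu2⟩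
    refine ⟨Submodule.smul_mem _ c hu, fun S hS hc => ?_, ?_⟩
    · obtain ⟨a, ha⟩ := hu1 S hS hc
      refine ⟨c • a, ?_⟩
      filter_upwards [Lp.coeFn_smul c u.fst, ha] with x hx h1 hxS
      simp [hx, h1 hxS]
    · filter_upwards [Lp.coeFn_smul c u.fst, hu2] with x hx h1 hxS
      simp [hx, h1 hxS]

/-- `p` is the `L²`-projection of `w` into `X`. -/
def IsL2Projection {d : ℕ} {Ω : TopologicalSpace.Opens (Space d)}
    (X : Submodule ℝ (H1Pair Ω)) (w : L2 Ω) (p : H1Pair Ω) : Prop :=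
  p ∈ X ∧ ∀ v ∈ X, inner ℝ p.fst v.fst = inner ℝ w v.fst

/-- `p` is the Ritz projection of `w` into `X`. -/
def IsRitzProjection {d : ℕ} {Ω : TopologicalSpace.Opens (Space d)}
    (X : Submodule ℝ (H1Pair Ω)) (w p : H1Pair Ω) : Prop :=
  p ∈ X ∧ ∀ v ∈ X, inner ℝ p.snd v.snd = inner ℝ w.snd v.snd

/-! ### The memory operator -/

/-- The coefficients `b₂, b₁, b₀` (functions of `x, t, s`) of the memory operator. -/
structure MemoryCoeff (d : ℕ) where
  b₂ : Space d → ℝ → ℝ → Matrix (Fin d) (Fin d) ℝ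
  b₁ : Space d → ℝ → ℝ → Fin d → ℝ
  b₀ : Space d → ℝ → ℝ → ℝ

/-- The coefficients are smooth on `Ω̄ × [0,T] × [0,T]`, and `b₂` is symmetric and positive
definite there. (Symmetry is part of `Matrix.PosDef`.) -/
structure MemoryCoeff.IsAdmissible {d : ℕ} (b : MemoryCoeff d) (Ω : Set (Space d)) (T : ℝ) :
    Prop where
  smooth₂ : ∀ i j, ContDiffOn ℝ ∞ (fun p : Space d × ℝ × ℝ => b.b₂ p.1 p.2.1 p.2.2 i j)
    (closure Ω ×ˢ Icc 0 T ×ˢ Icc 0 T)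
  smooth₁ : ∀ i, ContDiffOn ℝ ∞ (fun p : Space d × ℝ × ℝ => b.b₁ p.1 p.2.1 p.2.2 i)
    (closure Ω ×ˢ Icc 0 T ×ˢ Icc 0 T)
  smooth₀ : ContDiffOn ℝ ∞ (fun p : Space d × ℝ × ℝ => b.b₀ p.1 p.2.1 p.2.2)
    (closure Ω ×ˢ Icc 0 T ×ˢ Icc 0 T)
  posDef : ∀ x ∈ closure Ω, ∀ t ∈ Icc 0 T, ∀ s ∈ Icc 0 T, (b.b₂ x t s).PosDef

/-- `B(t,s,u,v) = (b₂(·,t,s)∇u, ∇v) - (b₁(·,t,s)u, ∇v) + (b₀(·,t,s)u, v)`. -/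
def MemoryCoeff.form {d : ℕ} (b : MemoryCoeff d) (Ω : TopologicalSpace.Opens (Space d))
    (t s : ℝ) (u v : H1Pair Ω) : ℝ :=
  (∫ x in (Ω : Set (Space d)), ∑ i, ∑ j, b.b₂ x t s i j * u.snd x j * v.snd x i)
    - (∫ x in (Ω : Set (Space d)), ∑ i, b.b₁ x t s i * u.fst x * v.snd x i)
    + ∫ x in (Ω : Set (Space d)), b.b₀ x t s * u.fst x * v.fst x

/-! ### The time grid, the L1 formula and the scheme -/

/-- The graded time nodes `t_n = T (n/N)^δ`. -/
def gridTime (T δ : ℝ) (N n : ℕ) : ℝ := T * ((n : ℝ) / N) ^ δ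

/-- The time steps `τ_n = t_n - t_{n-1}` (for `n ≥ 1`) of a sequence of nodes. -/
def timeStep (t : ℕ → ℝ) (n : ℕ) : ℝ := t n - t (n - 1)

/-- The discrete kernel `k_{n,j}` (for `1 ≤ j ≤ n`). -/
def l1Kernel (α : ℝ) (t : ℕ → ℝ) (n j : ℕ) : ℝ :=
  (timeStep t j)⁻¹ / Real.Gamma (1 - α) * ∫ s in (t (j - 1))..(t j), (t n - s) ^ (-α)

/-- The L1 approximation `∑_{j=1}^n k_{n,j} (u^j - u^{j-1})` of the Caputo derivative at `t_n`. -/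
def l1Derivative {V : Type*} [AddCommGroup V] [Module ℝ V] (α : ℝ) (t : ℕ → ℝ) (u : ℕ → V)
    (n : ℕ) : V :=
  ∑ j ∈ Finset.Icc 1 n, l1Kernel α t n j • (u j - u (j - 1))

/-- The extrapolation `ũ^{n-1} = (1 + τ_n/τ_{n-1}) u^{n-1} - (τ_n/τ_{n-1}) u^{n-2}`, `n ≥ 2`. -/
def extrapolate {V : Type*} [AddCommGroup V] [Module ℝ V] (t : ℕ → ℝ) (u : ℕ → V) (n : ℕ) : V :=
  (1 + timeStep t n / timeStep t (n - 1)) • u (n - 1)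
    - (timeStep t n / timeStep t (n - 1)) • u (n - 2)

/-- `B̄(t_n,t_j,u^j,v)`: the trapezoidal mean for `1 ≤ j ≤ n-2` and the left endpoint value for
`j = n-1`. -/
def memoryBar {d : ℕ} (b : MemoryCoeff d) (Ω : TopologicalSpace.Opens (Space d)) (t : ℕ → ℝ)
    (u : ℕ → H1Pair Ω) (n j : ℕ) (v : H1Pair Ω) : ℝ :=
  if j + 2 ≤ n then
    (1 / 2) * (b.form Ω (t n) (t j) (u j) v + b.form Ω (t n) (t (j + 1)) (u (j + 1)) v)
  else b.form Ω (t n) (t (n - 1)) (u (n - 1)) v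

/-- `u⁰, …, u^N` is a solution of the linearized fully discrete scheme in `X`, on the time nodes
`t`, with initial value `u₀` and right-hand sides `f^n`, whose `L²`-projections enter the
equations. -/
structure IsDiscreteSolution {d : ℕ} (Ω : TopologicalSpace.Opens (Space d))
    (X : Submodule ℝ (H1Pair Ω)) (α : ℝ) (M : ℝ → ℝ) (b : MemoryCoeff d) (t : ℕ → ℝ) (N : ℕ)
    (u₀ : H1Pair Ω) (f : ℕ → L2 Ω) (u : ℕ → H1Pair Ω) : Prop where
  mem : ∀ n, 1 ≤ n → n ≤ N → u n ∈ X
  initial : IsRitzProjection X u₀ (u 0)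
  first : ∃ fh : H1Pair Ω, IsL2Projection X (f 1) fh ∧ ∀ v ∈ X,
    inner ℝ (l1Derivative α t u 1).fst v.fst + M (‖(u 1).snd‖ ^ 2) * inner ℝ (u 1).snd v.snd
      = inner ℝ fh.fst v.fst + timeStep t 1 * b.form Ω (t 1) (t 1) (u 1) v
  step : ∀ n, 2 ≤ n → n ≤ N → ∃ fh : H1Pair Ω, IsL2Projection X (f n) fh ∧ ∀ v ∈ X,
    inner ℝ (l1Derivative α t u n).fst v.fst
        + M (‖(extrapolate t u n).snd‖ ^ 2) * inner ℝ (u n).snd v.snd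
      = inner ℝ fh.fst v.fst
        + ∑ j ∈ Finset.Icc 1 (n - 1), timeStep t (j + 1) * memoryBar b Ω t u n j v

end Kirchhoff

end

/-!
The memory form enters the estimate only through its boundedness and its Lipschitz continuity in
the first time argument, both with respect to the `H¹₀` inner product `(∇u, ∇v)`. The scheme is
therefore stable in every finite-dimensional subspace `X` of `H¹₀(Ω)`, with constants that do not
depend on `X`.

Write the scheme as `(D uⁿ, v) + Mₙ (∇uⁿ, ∇v) = (fⁿ, v) + gⁿ(v)`, where `D` is the L1 formula and
`gⁿ` the memory functional. The `L²` product and the `H¹₀` product are simultaneously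
diagonalizable on `X` (`exists_orthonormalBasis_diagonal`), so that along each common eigenvector
the scheme becomes `μ D uⁿ + Mₙ uⁿ = φⁿ + γⁿ` with scalars `μ ≥ 0` and `Mₙ ≥ m₀`. Summation by
parts writes `D uⁿ = ∑_{j<n} c_{n,j} (uⁿ - uʲ)` with nonnegative weights, whence a maximum principle
(`le_add_div_of_pastDiff_le`, `abs_le_div_of_pastDiff_eq`). The solution is split in two parts.

* The response to `f` and to the initial value is bounded in the gradient norm by the energy
  argument that amounts to testing with the discrete Laplacian.
* The response to `g` is bounded in each mode by `m₀⁻¹` times the variation of `γ` up to time `n`.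
  No regularity of `n ↦ Mₙ` is needed for this. Minkowski's inequality over the modes turns it into
  the bound `m₀⁻¹ ∑_{m≤n} ‖gᵐ - gᵐ⁻¹‖` in the gradient norm.

This is `norm_le_of_abstract_scheme`. The functional `g` is estimated in `H⁻¹` only, and its
regularity in time takes the place of regularity in space: since the time steps are nondecreasing,
its increments satisfy `‖gᵐ - gᵐ⁻¹‖ ≤ C τₘ max_{1≤j<m} ‖∇uʲ‖` for `m ≥ 2` in the dual norm
(`norm_memoryTerm_sub_le`). A discrete Gronwall argument (`le_exp_of_gronwall`) concludes. The first
step is implicit in the memory term, which is absorbed when `τ₁` is small.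

The remaining ingredients are Poincaré's inequality on `H¹₀(Ω)`, the bounds for the memory form, and
the finite dimension of the finite element space.
-/

namespace Kirchhoff

/-! ### Discrete fractional difference operators -/

/-- The operator `v ↦ ∑_{j<n} c_{n,j} (vⁿ - vʲ)`. With nonnegative weights it obeys a maximum
principle; the L1 formula is of this form. -/
def pastDiff {V : Type*} [AddCommGroup V] [Module ℝ V] (c : ℕ → ℕ → ℝ) (v : ℕ → V) (n : ℕ) : V :=
  ∑ j ∈ Finset.range n, c n j • (v n - v j)

theorem map_pastDiff {V W : Type*} [AddCommGroup V] [Module ℝ V] [AddCommGroup W] [Module ℝ W]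
    (L : V →ₗ[ℝ] W) (c : ℕ → ℕ → ℝ) (v : ℕ → V) (n : ℕ) :
    L (pastDiff c v n) = pastDiff c (fun j => L (v j)) n := by
  simp [pastDiff, map_sum]

theorem pastDiff_congr {V : Type*} [AddCommGroup V] [Module ℝ V] {c : ℕ → ℕ → ℝ} {v w : ℕ → V}
    {n : ℕ} (h : ∀ j ≤ n, v j = w j) : pastDiff c v n = pastDiff c w n := by
  refine Finset.sum_congr rfl fun j hj => ?_
  rw [h n le_rfl, h j (Finset.mem_range.1 hj).le]

/-- Summation by parts. -/
theorem sum_smul_sub_pred_eq {V : Type*} [AddCommGroup V] [Module ℝ V] (κ : ℕ → ℝ) (h0 : κ 0 = 0)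
    (v : ℕ → V) (n : ℕ) :
    ∑ j ∈ Finset.Icc 1 n, κ j • (v j - v (j - 1))
      = ∑ j ∈ Finset.range n, (κ (j + 1) - κ j) • (v n - v j) := by
  induction n with
  | zero => simp
  | succ n ih =>
    have hs : ∀ j, (κ (j + 1) - κ j) • (v (n + 1) - v j)
        = (κ (j + 1) - κ j) • (v n - v j) + (κ (j + 1) - κ j) • (v (n + 1) - v n) := by
      intro j
      rw [← smul_add]
      congr 1
      abel
    rw [Finset.sum_Icc_succ_top (by omega), ih, Finset.sum_congr rfl fun j _ => hs j,
      Finset.sum_add_distrib, ← Finset.sum_smul, Finset.sum_range_sub, h0,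
      Finset.sum_range_succ]
    simp

/-- Maximum principle: a bound on the difference operator bounds the sequence. -/
theorem le_add_div_of_pastDiff_le {c : ℕ → ℕ → ℝ} {N : ℕ} {k₀ F : ℝ} {w : ℕ → ℝ} (hk₀ : 0 < k₀)
    (hc : ∀ n ≤ N, ∀ j < n, 0 ≤ c n j) (hc0 : ∀ n, 1 ≤ n → n ≤ N → k₀ ≤ c n 0) (hF : 0 ≤ F)
    (h : ∀ n, 1 ≤ n → n ≤ N → pastDiff c w n ≤ F) :
    ∀ n ≤ N, w n ≤ w 0 + F / k₀ := by
  intro n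
  induction n using Nat.strong_induction_on with
  | _ n ih =>
    intro hn
    rcases Nat.eq_zero_or_pos n with rfl | hpos
    · have := div_nonneg hF hk₀.le
      linarith
    by_contra! hlt
    have h1 : c n 0 • (w n - w 0) ≤ pastDiff c w n := by
      refine Finset.single_le_sum (f := fun j => c n j • (w n - w j)) (fun j hj => ?_)
        (Finset.mem_range.2 hpos)
      have hj' := Finset.mem_range.1 hj
      have := ih j hj' (by omega)
      exact mul_nonneg (hc n hn j hj') (by linarith)
    have h2 : F < k₀ * (w n - w 0) := by
      have : F / k₀ < w n - w 0 := by linarith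
      rwa [div_lt_iff₀' hk₀] at this
    have h3 : k₀ * (w n - w 0) ≤ c n 0 * (w n - w 0) := by
      have : 0 ≤ F / k₀ := div_nonneg hF hk₀.le
      exact mul_le_mul_of_nonneg_right (hc0 n hpos hn) (by linarith)
    have h4 := h n hpos hn
    simp only [smul_eq_mul] at h1
    linarith

/-- One-sided maximum principle for `μ D y + M y = g`, with a nondecreasing bound on `g` and with
`M ≥ m₀` otherwise arbitrary. -/
theorem le_div_of_pastDiff_eq {c : ℕ → ℕ → ℝ} {N : ℕ} {μ m₀ : ℝ} {M y g G : ℕ → ℝ} (hμ : 0 ≤ μ)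
    (hm₀ : 0 < m₀) (hM : ∀ n, 1 ≤ n → n ≤ N → m₀ ≤ M n)
    (hc : ∀ n ≤ N, ∀ j < n, 0 ≤ c n j)
    (h : ∀ n, 1 ≤ n → n ≤ N → μ * pastDiff c y n + M n * y n = g n) (hy : y 0 = 0)
    (hG : Monotone G) (hG0 : 0 ≤ G 0) (hgG : ∀ n, 1 ≤ n → n ≤ N → g n ≤ G n) :
    ∀ n ≤ N, y n ≤ G n / m₀ := by
  intro n
  induction n using Nat.strong_induction_on with
  | _ n ih =>
    intro hn
    have hGn : 0 ≤ G n := hG0.trans (hG (Nat.zero_le n))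
    rcases Nat.eq_zero_or_pos n with rfl | hpos
    · rw [hy]
      positivity
    by_contra! hlt
    have h1 : 0 ≤ pastDiff c y n := by
      refine Finset.sum_nonneg fun j hj => ?_
      have hj' := Finset.mem_range.1 hj
      have h2 := ih j hj' (by omega)
      have h3 : G j / m₀ ≤ G n / m₀ := by
        gcongr
        exact hG hj'.le
      exact mul_nonneg (hc n hn j hj') (by linarith)
    have h4 : 0 ≤ μ * pastDiff c y n := mul_nonneg hμ h1
    have h5 := h n hpos hn
    have h6 := hgG n hpos hn
    have hy0 : 0 ≤ y n := le_trans (by positivity) hlt.le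
    have h7 : m₀ * y n ≤ M n * y n := mul_le_mul_of_nonneg_right (hM n hpos hn) hy0
    rw [div_lt_iff₀' hm₀] at hlt
    linarith

theorem abs_le_div_of_pastDiff_eq {c : ℕ → ℕ → ℝ} {N : ℕ} {μ m₀ : ℝ} {M y g G : ℕ → ℝ}
    (hμ : 0 ≤ μ) (hm₀ : 0 < m₀) (hM : ∀ n, 1 ≤ n → n ≤ N → m₀ ≤ M n)
    (hc : ∀ n ≤ N, ∀ j < n, 0 ≤ c n j)
    (h : ∀ n, 1 ≤ n → n ≤ N → μ * pastDiff c y n + M n * y n = g n) (hy : y 0 = 0)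
    (hG : Monotone G) (hG0 : 0 ≤ G 0) (hgG : ∀ n, 1 ≤ n → n ≤ N → |g n| ≤ G n) :
    ∀ n ≤ N, |y n| ≤ G n / m₀ := by
  intro n hn
  refine abs_le'.2 ⟨?_, ?_⟩
  · exact le_div_of_pastDiff_eq hμ hm₀ hM hc h hy hG hG0
      (fun n h1 h2 => (le_abs_self _).trans (hgG n h1 h2)) n hn
  · refine le_div_of_pastDiff_eq (y := fun n => - y n) (g := fun n => - g n) hμ hm₀ hM hc
      (fun n h1 h2 => ?_) (by simp [hy]) hG hG0
      (fun n h1 h2 => (neg_le_abs _).trans (hgG n h1 h2)) n hn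
    have := map_pastDiff (-LinearMap.id : ℝ →ₗ[ℝ] ℝ) c y n
    simp only [LinearMap.neg_apply, LinearMap.id_coe, id_eq] at this
    rw [← this, ← h n h1 h2]
    ring

/-- The convexity inequality `½ D(v²) ≤ v D v`. -/
theorem pastDiff_sq_le {c : ℕ → ℕ → ℝ} {n : ℕ} (hc : ∀ j < n, 0 ≤ c n j) (v : ℕ → ℝ) :
    pastDiff c (fun j => v j ^ 2) n ≤ 2 * (v n * pastDiff c v n) := by
  simp only [pastDiff, Finset.mul_sum, smul_eq_mul]
  refine Finset.sum_le_sum fun j hj => ?_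
  nlinarith [mul_nonneg (hc j (Finset.mem_range.1 hj)) (sq_nonneg (v n - v j))]

/-- The scalar implicit equation `μ D v + M v = φ` is solvable. -/
theorem exists_pastDiff_eq {c : ℕ → ℕ → ℝ} {N : ℕ} {μ : ℝ} {M : ℕ → ℝ} (hμ : 0 ≤ μ)
    (hM : ∀ n, 1 ≤ n → n ≤ N → 0 < M n) (hc : ∀ n ≤ N, ∀ j < n, 0 ≤ c n j) (φ : ℕ → ℝ) (a : ℝ) :
    ∃ v : ℕ → ℝ, v 0 = a ∧ ∀ n, 1 ≤ n → n ≤ N → μ * pastDiff c v n + M n * v n = φ n := by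
  classical
  let Φ : ∀ n : ℕ, (∀ j, j < n → ℝ) → ℝ := fun n w =>
    if n = 0 then a else
      (φ n + μ * ∑ j ∈ Finset.range n, c n j * (if hj : j < n then w j hj else 0))
        / (μ * ∑ j ∈ Finset.range n, c n j + M n)
  let v : ℕ → ℝ := Nat.lt_wfRel.wf.fix Φ
  have hv : ∀ n, v n = Φ n (fun j _ => v j) := fun n => WellFounded.fix_eq _ _ _
  refine ⟨v, (hv 0).trans (if_pos rfl), fun n h1 hn => ?_⟩
  have hpos : 0 < μ * ∑ j ∈ Finset.range n, c n j + M n := by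
    have : 0 ≤ ∑ j ∈ Finset.range n, c n j :=
      Finset.sum_nonneg fun j hj => hc n hn j (Finset.mem_range.1 hj)
    have := mul_nonneg hμ this
    linarith [hM n h1 hn]
  have hs : ∑ j ∈ Finset.range n, c n j * (if _ : j < n then v j else 0)
      = ∑ j ∈ Finset.range n, c n j * v j :=
    Finset.sum_congr rfl fun j hj => by simp [Finset.mem_range.1 hj]
  have h2 : v n = (φ n + μ * ∑ j ∈ Finset.range n, c n j * v j)
        / (μ * ∑ j ∈ Finset.range n, c n j + M n) := by
    conv_lhs => rw [hv]
    simp only [Φ, if_neg (show n ≠ 0 by omega)]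
    rw [hs]
  rw [eq_div_iff hpos.ne'] at h2
  have h3 : pastDiff c v n
      = (∑ j ∈ Finset.range n, c n j) * v n - ∑ j ∈ Finset.range n, c n j * v j := by
    simp [pastDiff, mul_sub, Finset.sum_sub_distrib, Finset.sum_mul]
  rw [h3]
  linarith

/-! ### Stability of the abstract scheme -/

section Hilbert

variable {V H : Type*} [NormedAddCommGroup V] [InnerProductSpace ℝ V]
  [NormedAddCommGroup H] [InnerProductSpace ℝ H]

/-- Minkowski's inequality for the moduli of the coordinates in an orthonormal basis. -/
theorem norm_le_sum_norm_of_abs_inner_le {ι κ : Type*} [Fintype ι] (e : OrthonormalBasis ι ℝ V)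
    (s : Finset κ) (a : κ → V) (y : V) {r : ℝ} (hr : 0 ≤ r)
    (h : ∀ k, |inner ℝ y (e k)| ≤ r * ∑ m ∈ s, |inner ℝ (a m) (e k)|) :
    ‖y‖ ≤ r * ∑ m ∈ s, ‖a m‖ := by
  have hn : ∀ x : V, ‖x‖ = ‖(WithLp.toLp 2 fun k => |inner ℝ x (e k)| : EuclideanSpace ℝ ι)‖ := by
    intro x
    rw [← e.repr.norm_map, EuclideanSpace.norm_eq, EuclideanSpace.norm_eq]
    simp [OrthonormalBasis.repr_apply_apply, real_inner_comm]
  have h1 : ‖y‖ ≤ ‖r • ∑ m ∈ s,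
      (WithLp.toLp 2 fun k => |inner ℝ (a m) (e k)| : EuclideanSpace ℝ ι)‖ := by
    rw [hn, EuclideanSpace.norm_eq, EuclideanSpace.norm_eq]
    refine Real.sqrt_le_sqrt (Finset.sum_le_sum fun k _ => ?_)
    have := h k
    simp only [Real.norm_eq_abs, abs_abs, sq_abs, PiLp.smul_apply, WithLp.ofLp_sum,
      Finset.sum_apply, smul_eq_mul]
    rw [← sq_abs]
    exact pow_le_pow_left₀ (abs_nonneg _) this 2
  refine h1.trans ?_
  rw [norm_smul, Real.norm_of_nonneg hr]
  refine mul_le_mul_of_nonneg_left ((norm_sum_le _ _).trans_eq ?_) hr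
  exact Finset.sum_congr rfl fun m _ => (hn _).symm

theorem norm_sq_eq_sum_inner_sq {ι : Type*} [Fintype ι] (e : OrthonormalBasis ι ℝ V) (x : V) :
    ‖x‖ ^ 2 = ∑ k, inner ℝ x (e k) ^ 2 := by
  rw [← e.sum_sq_norm_inner_left x]
  simp

/-- Bessel's inequality for the orthogonal vectors `J e_k`, some of which may vanish: the
corresponding terms are `x / 0 = 0`. -/
theorem sum_inner_sq_div_le {ι : Type*} [Fintype ι] (J : V →ₗ[ℝ] H) (e : OrthonormalBasis ι ℝ V)
    {μ : ι → ℝ} (hμ : ∀ k v, inner ℝ (J v) (J (e k)) = μ k * inner ℝ v (e k)) (x : H) :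
    ∑ k, inner ℝ x (J (e k)) ^ 2 / μ k ≤ ‖x‖ ^ 2 := by
  classical
  set φ : ι → ℝ := fun k => inner ℝ x (J (e k)) with hφ
  set S : ℝ := ∑ k, φ k ^ 2 / μ k with hS
  set p : V := ∑ k, (φ k / μ k) • e k with hp
  have hJp : ∀ z : H, inner ℝ z (J p) = ∑ k, φ k / μ k * inner ℝ z (J (e k)) := by
    intro z
    simp only [hp, map_sum, map_smul, inner_sum, inner_smul_right]
  have hort : ∀ k, inner ℝ p (e k) = φ k / μ k := by
    intro k
    simp [hp, sum_inner, inner_smul_left, OrthonormalBasis.inner_eq_ite]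
  have h1 : inner ℝ x (J p) = S := by
    rw [hJp]
    exact Finset.sum_congr rfl fun k _ => by simp only [hφ]; ring
  have h2 : ‖J p‖ ^ 2 = S := by
    rw [← real_inner_self_eq_norm_sq, hJp]
    refine Finset.sum_congr rfl fun k _ => ?_
    rw [hμ, hort]
    rcases eq_or_ne (μ k) 0 with h0 | h0
    · simp [h0]
    · field_simp
  have h3 := real_inner_le_norm x (J p)
  rw [h1] at h3
  nlinarith [sq_nonneg (‖x‖ - ‖J p‖)]

variable [FiniteDimensional ℝ V] [CompleteSpace H]

/-- The two inner products `⟪u, v⟫` and `⟪J u, J v⟫` on `V` are simultaneously diagonalizable. -/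
theorem exists_orthonormalBasis_diagonal (J : V →ₗ[ℝ] H) :
    ∃ (e : OrthonormalBasis (Fin (Module.finrank ℝ V)) ℝ V) (μ : Fin (Module.finrank ℝ V) → ℝ),
      (∀ k, 0 ≤ μ k) ∧ ∀ k v, inner ℝ (J v) (J (e k)) = μ k * inner ℝ v (e k) := by
  have : CompleteSpace V := FiniteDimensional.complete ℝ V
  let Jc : V →L[ℝ] H := LinearMap.toContinuousLinearMap J
  let S : V →L[ℝ] V := (ContinuousLinearMap.adjoint Jc).comp Jc
  have hS : ∀ x y, inner ℝ x (S y) = inner ℝ (J x) (J y) := by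
    intro x y
    simp only [S, ContinuousLinearMap.comp_apply, ContinuousLinearMap.adjoint_inner_right]
    rfl
  have hsym : (S : V →ₗ[ℝ] V).IsSymmetric := by
    intro x y
    simp only [ContinuousLinearMap.coe_coe]
    rw [hS, real_inner_comm, hS, real_inner_comm]
  have key : ∀ k v, inner ℝ (J v) (J (hsym.eigenvectorBasis rfl k))
      = hsym.eigenvalues rfl k * inner ℝ v (hsym.eigenvectorBasis rfl k) := by
    intro k v
    rw [← hS]
    have := hsym.apply_eigenvectorBasis rfl k
    simp only [ContinuousLinearMap.coe_coe] at this
    rw [this, inner_smul_right]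
    simp
  refine ⟨hsym.eigenvectorBasis rfl, hsym.eigenvalues rfl, fun k => ?_, key⟩
  have h1 := key k (hsym.eigenvectorBasis rfl k)
  rw [real_inner_self_eq_norm_sq, real_inner_self_eq_norm_sq, OrthonormalBasis.norm_eq_one] at h1
  nlinarith [sq_nonneg ‖J (hsym.eigenvectorBasis rfl k)‖]

/-- Stability of `(J D uⁿ, J v) + Mₙ (uⁿ, v) = (φⁿ, J v) + (gⁿ, v)`. The coefficients `Mₙ` only
have to be bounded below, without any regularity in `n`; in exchange `g` enters through its total
variation. Along each common eigenvector `e_k` of the two inner products, `u` is split into the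
response `v_k` to `φ` and to the initial value, estimated by energy, and the response `u_k - v_k`
to `g`, estimated by the maximum principle. -/
theorem norm_le_of_abstract_scheme (J : V →ₗ[ℝ] H) {c : ℕ → ℕ → ℝ} {N : ℕ} {k₀ m₀ F : ℝ}
    {M : ℕ → ℝ} {u g : ℕ → V} {φ : ℕ → H} (hk₀ : 0 < k₀) (hm₀ : 0 < m₀)
    (hc : ∀ n ≤ N, ∀ j < n, 0 ≤ c n j) (hc0 : ∀ n, 1 ≤ n → n ≤ N → k₀ ≤ c n 0)
    (hM : ∀ n, 1 ≤ n → n ≤ N → m₀ ≤ M n)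
    (heq : ∀ n, 1 ≤ n → n ≤ N → ∀ v, inner ℝ (J (pastDiff c u n)) (J v) + M n * inner ℝ (u n) v
      = inner ℝ (φ n) (J v) + inner ℝ (g n) v)
    (hg0 : g 0 = 0) (hφ : ∀ n, 1 ≤ n → n ≤ N → ‖φ n‖ ≤ F) {n : ℕ} (hn : n ≤ N) :
    ‖u n‖ ≤ Real.sqrt (‖u 0‖ ^ 2 + F ^ 2 / (2 * m₀) / k₀)
      + m₀⁻¹ * ∑ m ∈ Finset.Icc 1 n, ‖g m - g (m - 1)‖ := by
  obtain ⟨e, μ, hμ0, hμ⟩ := exists_orthonormalBasis_diagonal J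
  have hMpos : ∀ n, 1 ≤ n → n ≤ N → 0 < M n := fun n h1 h2 => hm₀.trans_le (hM n h1 h2)
  choose v hv0 hv using fun k => exists_pastDiff_eq (hμ0 k) hMpos hc
    (fun n => inner ℝ (φ n) (J (e k))) (inner ℝ (u 0) (e k))
  -- the coordinates of `u` satisfy decoupled scalar equations
  have hu : ∀ k n, 1 ≤ n → n ≤ N → μ k * pastDiff c (fun j => inner ℝ (u j) (e k)) n
      + M n * inner ℝ (u n) (e k) = inner ℝ (φ n) (J (e k)) + inner ℝ (g n) (e k) := by
    intro k n h1 h2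
    rw [← heq n h1 h2 (e k), hμ]
    have := map_pastDiff ((innerₗ V).flip (e k)) c u n
    simp only [LinearMap.flip_apply, innerₗ_apply_apply] at this
    rw [this]
  have hF : 0 ≤ F ^ 2 / (2 * m₀) := by positivity
  -- energy estimate for the response to `φ`
  have hvmode : ∀ k n, 1 ≤ n → n ≤ N → v k n * pastDiff c (v k) n
      ≤ inner ℝ (φ n) (J (e k)) ^ 2 / μ k / (4 * m₀) := by
    intro k n h1 h2
    have h3 := hv k n h1 h2
    have hMn := hM n h1 h2
    rcases (hμ0 k).eq_or_lt with h0 | h0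
    · have hJ : J (e k) = 0 := by
        have := hμ k (e k)
        rw [← h0, zero_mul, inner_self_eq_zero] at this
        exact this
      rw [← h0, hJ] at h3
      have hvn : v k n = 0 := by
        simpa [(hMpos n h1 h2).ne'] using h3
      simp [hvn, ← h0]
    · rw [div_div, le_div_iff₀ (by positivity)]
      have h4 : m₀ * v k n ^ 2 ≤ M n * v k n ^ 2 :=
        mul_le_mul_of_nonneg_right hMn (sq_nonneg _)
      have h5 : μ k * (v k n * pastDiff c (v k) n)
          = inner ℝ (φ n) (J (e k)) * v k n - M n * v k n ^ 2 := by
        rw [← h3]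
        ring
      nlinarith [sq_nonneg (inner ℝ (φ n) (J (e k)) - 2 * m₀ * v k n)]
  have hvsum : ∀ n ≤ N, ∑ k, v k n ^ 2 ≤ ‖u 0‖ ^ 2 + F ^ 2 / (2 * m₀) / k₀ := by
    have h0 : ∑ k, v k 0 ^ 2 = ‖u 0‖ ^ 2 := by
      rw [norm_sq_eq_sum_inner_sq e]
      simp [hv0]
    rw [← h0]
    refine le_add_div_of_pastDiff_le (w := fun n => ∑ k, v k n ^ 2) hk₀ hc hc0 hF
      fun n h1 h2 => ?_
    have h3 : pastDiff c (fun n => ∑ k, v k n ^ 2) n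
        = ∑ k, pastDiff c (fun n => v k n ^ 2) n := by
      simp only [pastDiff]
      rw [Finset.sum_comm]
      refine Finset.sum_congr rfl fun j _ => ?_
      rw [← Finset.smul_sum, Finset.sum_sub_distrib]
    rw [h3]
    calc ∑ k, pastDiff c (fun n => v k n ^ 2) n
        ≤ ∑ k, 2 * (inner ℝ (φ n) (J (e k)) ^ 2 / μ k / (4 * m₀)) :=
          Finset.sum_le_sum fun k _ => (pastDiff_sq_le (hc n h2) (v k)).trans
            (by linarith [hvmode k n h1 h2])
      _ = (∑ k, inner ℝ (φ n) (J (e k)) ^ 2 / μ k) / (2 * m₀) := by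
          rw [Finset.sum_div]
          refine Finset.sum_congr rfl fun k _ => ?_
          ring
      _ ≤ F ^ 2 / (2 * m₀) := by
          gcongr
          exact (sum_inner_sq_div_le J e hμ (φ n)).trans
            (pow_le_pow_left₀ (norm_nonneg _) (hφ n h1 h2) 2)
  set p : V := ∑ k, v k n • e k with hp
  have hpk : ∀ k, inner ℝ p (e k) = v k n := by
    intro k
    simp [hp, sum_inner, inner_smul_left, OrthonormalBasis.inner_eq_ite]
  have hpn : ‖p‖ ≤ Real.sqrt (‖u 0‖ ^ 2 + F ^ 2 / (2 * m₀) / k₀) := by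
    refine Real.le_sqrt_of_sq_le ?_
    rw [norm_sq_eq_sum_inner_sq e]
    simpa only [hpk] using hvsum n hn
  -- maximum principle for the response to `g`
  have hy : ‖u n - p‖ ≤ m₀⁻¹ * ∑ m ∈ Finset.Icc 1 n, ‖g m - g (m - 1)‖ := by
    refine norm_le_sum_norm_of_abs_inner_le e _ _ _ (inv_nonneg.2 hm₀.le) fun k => ?_
    rw [inner_sub_left, hpk, inv_mul_eq_div]
    refine abs_le_div_of_pastDiff_eq (c := c) (N := N) (M := M) (g := fun n => inner ℝ (g n) (e k))
      (y := fun n => inner ℝ (u n) (e k) - v k n)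
      (G := fun n => ∑ m ∈ Finset.Icc 1 n, |inner ℝ (g m - g (m - 1)) (e k)|)
      (hμ0 k) hm₀ hM hc (fun n h1 h2 => ?_) (by simp [hv0]) (fun i j hij => ?_) (by simp)
      (fun n h1 h2 => ?_) n hn
    · have h3 : pastDiff c (fun n => inner ℝ (u n) (e k) - v k n) n
          = pastDiff c (fun n => inner ℝ (u n) (e k)) n - pastDiff c (v k) n := by
        simp only [pastDiff, ← Finset.sum_sub_distrib, smul_eq_mul]
        exact Finset.sum_congr rfl fun j _ => by ring
      rw [h3]
      linarith [hu k n h1 h2, hv k n h1 h2]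
    · exact Finset.sum_le_sum_of_subset_of_nonneg (Finset.Icc_subset_Icc_right hij)
        fun _ _ _ => abs_nonneg _
    · have h3 : ∀ n, g n = ∑ m ∈ Finset.Icc 1 n, (g m - g (m - 1)) := by
        intro n
        induction n with
        | zero => simp [hg0]
        | succ n ih =>
          rw [Finset.sum_Icc_succ_top (by omega), ← ih]
          simp
      have h4 : inner ℝ (g n) (e k) = ∑ m ∈ Finset.Icc 1 n, inner ℝ (g m - g (m - 1)) (e k) := by
        rw [← sum_inner, ← h3]
      simp only [h4]
      exact Finset.abs_sum_le_sum_abs _ _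
  calc ‖u n‖ = ‖p + (u n - p)‖ := by congr 1; abel
    _ ≤ _ := (norm_add_le _ _).trans (add_le_add hpn hy)

end Hilbert

/-! ### The graded grid and the L1 kernel -/

theorem gridTime_zero (T : ℝ) {δ : ℝ} (hδ : 1 ≤ δ) (N : ℕ) : gridTime T δ N 0 = 0 := by
  simp [gridTime, Real.zero_rpow (by linarith : δ ≠ 0)]

theorem gridTime_self (T δ : ℝ) {N : ℕ} (hN : 1 ≤ N) : gridTime T δ N N = T := by
  have : (N : ℝ) ≠ 0 := by positivity
  simp [gridTime, div_self this]

theorem strictMono_gridTime {T δ : ℝ} (hT : 0 < T) (hδ : 1 ≤ δ) {N : ℕ} (hN : 1 ≤ N) :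
    StrictMono (gridTime T δ N) := by
  intro i j hij
  have hN' : (0 : ℝ) < N := by positivity
  have hij' : (i : ℝ) < j := by exact_mod_cast hij
  unfold gridTime
  gcongr

/-- By convexity of the grading function, the time steps are nondecreasing. -/
theorem timeStep_gridTime_le_succ {T δ : ℝ} (hT : 0 < T) (hδ : 1 ≤ δ) (N : ℕ) {n : ℕ}
    (hn : 1 ≤ n) :
    timeStep (gridTime T δ N) n ≤ timeStep (gridTime T δ N) (n + 1) := by
  obtain ⟨m, rfl⟩ := Nat.exists_eq_add_of_le' hn
  have h := (convexOn_rpow hδ).2 (x := (m : ℝ) / N) (y := ((m + 1 + 1 : ℕ) : ℝ) / N)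
    (show (0 : ℝ) ≤ _ by positivity) (show (0 : ℝ) ≤ _ by positivity)
    (show (0 : ℝ) ≤ 1 / 2 by norm_num) (show (0 : ℝ) ≤ 1 / 2 by norm_num) (by norm_num)
  have he : 1 / 2 * ((m : ℝ) / N) + 1 / 2 * (((m + 1 + 1 : ℕ) : ℝ) / N)
      = ((m + 1 : ℕ) : ℝ) / N := by
    push_cast
    ring
  simp only [smul_eq_mul] at h
  rw [he] at h
  simp only [timeStep, gridTime, Nat.add_sub_cancel]
  nlinarith

theorem intervalIntegrable_sub_rpow_neg {α : ℝ} (hα : α < 1) (x a b : ℝ) :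
    IntervalIntegrable (fun s => (x - s) ^ (-α)) volume a b := by
  have h := (intervalIntegral.intervalIntegrable_rpow' (a := x - a) (b := x - b)
    (show -1 < -α by linarith)).comp_sub_left x
  simpa using h

/-- The kernel is the mean over one time step of a nondecreasing function of `s`, hence is at least
its left endpoint value. -/
theorem le_l1Kernel {α : ℝ} (hα : α ∈ Ioo (0 : ℝ) 1) {t : ℕ → ℝ} (ht : StrictMono t) {n j : ℕ}
    (hj : 1 ≤ j) (hjn : j ≤ n) :
    (t n - t (j - 1)) ^ (-α) / Real.Gamma (1 - α) ≤ l1Kernel α t n j := by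
  have hτ : 0 < timeStep t j := sub_pos.2 (ht (by omega))
  have hΓ : 0 < Real.Gamma (1 - α) := Real.Gamma_pos_of_pos (by linarith [hα.2])
  have hmono := intervalIntegral.integral_mono_on_of_le_Ioo (μ := volume)
    (a := t (j - 1)) (b := t j) (f := fun _ => (t n - t (j - 1)) ^ (-α))
    (g := fun s => (t n - s) ^ (-α)) (ht.monotone (Nat.sub_le _ _)) (by simp)
    (intervalIntegrable_sub_rpow_neg hα.2 _ _ _) (fun s hs => by
      refine Real.rpow_le_rpow_of_nonpos ?_ ?_ (by linarith [hα.1])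
      · linarith [hs.2, ht.monotone hjn]
      · linarith [hs.1])
  rw [intervalIntegral.integral_const, smul_eq_mul] at hmono
  unfold l1Kernel
  rw [div_mul_eq_mul_div]
  gcongr
  rw [inv_mul_eq_div, le_div_iff₀' hτ]
  exact hmono

theorem l1Kernel_le {α : ℝ} (hα : α ∈ Ioo (0 : ℝ) 1) {t : ℕ → ℝ} (ht : StrictMono t) {n j : ℕ}
    (hj : 1 ≤ j) (hjn : j < n) :
    l1Kernel α t n j ≤ (t n - t j) ^ (-α) / Real.Gamma (1 - α) := by
  have hτ : 0 < timeStep t j := sub_pos.2 (ht (by omega))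
  have hΓ : 0 < Real.Gamma (1 - α) := Real.Gamma_pos_of_pos (by linarith [hα.2])
  have hmono := intervalIntegral.integral_mono_on_of_le_Ioo (μ := volume)
    (a := t (j - 1)) (b := t j) (g := fun _ => (t n - t j) ^ (-α))
    (f := fun s => (t n - s) ^ (-α)) (ht.monotone (Nat.sub_le _ _))
    (intervalIntegrable_sub_rpow_neg hα.2 _ _ _) (by simp) (fun s hs => by
      refine Real.rpow_le_rpow_of_nonpos ?_ ?_ (by linarith [hα.1])
      · linarith [ht hjn]
      · linarith [hs.2])
  rw [intervalIntegral.integral_const, smul_eq_mul] at hmono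
  unfold l1Kernel
  rw [div_mul_eq_mul_div]
  gcongr
  rw [inv_mul_eq_div, div_le_iff₀' hτ]
  exact hmono

/-- The weights of the L1 formula, written with the differences `uⁿ - uʲ`. Since `0⁻¹ = 0`, the
kernel vanishes at `j = 0`, so that the first weight is `k_{n,1}`. -/
noncomputable def l1Weight (α : ℝ) (t : ℕ → ℝ) (n j : ℕ) : ℝ :=
  l1Kernel α t n (j + 1) - l1Kernel α t n j

theorem l1Kernel_zero (α : ℝ) (t : ℕ → ℝ) (n : ℕ) : l1Kernel α t n 0 = 0 := by
  simp [l1Kernel, timeStep]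

theorem l1Derivative_eq_pastDiff {V : Type*} [AddCommGroup V] [Module ℝ V] (α : ℝ) (t : ℕ → ℝ)
    (u : ℕ → V) (n : ℕ) : l1Derivative α t u n = pastDiff (l1Weight α t) u n :=
  sum_smul_sub_pred_eq _ (l1Kernel_zero α t n) u n

theorem l1Weight_nonneg {α : ℝ} (hα : α ∈ Ioo (0 : ℝ) 1) {t : ℕ → ℝ} (ht : StrictMono t)
    {n j : ℕ} (hj : j < n) : 0 ≤ l1Weight α t n j := by
  have h := le_l1Kernel hα ht (Nat.le_add_left 1 j) hj
  rw [Nat.add_sub_cancel] at h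
  rw [l1Weight, sub_nonneg]
  rcases Nat.eq_zero_or_pos j with rfl | hpos
  · rw [l1Kernel_zero]
    refine le_trans ?_ h
    have hΓ : 0 < Real.Gamma (1 - α) := Real.Gamma_pos_of_pos (by linarith [hα.2])
    have := sub_pos.2 (ht hj)
    positivity
  · exact (l1Kernel_le hα ht hpos hj).trans h

theorem le_l1Weight_zero {α T : ℝ} (hα : α ∈ Ioo (0 : ℝ) 1) {t : ℕ → ℝ} (ht : StrictMono t)
    {n : ℕ} (hn : 1 ≤ n) (hT : t n - t 0 ≤ T) :
    T ^ (-α) / Real.Gamma (1 - α) ≤ l1Weight α t n 0 := by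
  have h := le_l1Kernel hα ht le_rfl hn
  rw [l1Weight, l1Kernel_zero, sub_zero]
  refine le_trans ?_ h
  have hΓ : 0 < Real.Gamma (1 - α) := Real.Gamma_pos_of_pos (by linarith [hα.2])
  gcongr ?_ / _
  exact Real.rpow_le_rpow_of_nonpos (sub_pos.2 (ht (by omega))) hT (by linarith [hα.1])

theorem sum_timeStep_succ (t : ℕ → ℝ) (n : ℕ) :
    ∑ j ∈ Finset.Icc 1 n, timeStep t (j + 1) = t (n + 1) - t 1 := by
  induction n with
  | zero => simp
  | succ n ih =>
    rw [Finset.sum_Icc_succ_top (by omega), ih]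
    simp [timeStep]

/-! ### Variation of the memory term and the discrete Gronwall argument -/

section Memory

variable {V : Type*} [NormedAddCommGroup V] [InnerProductSpace ℝ V]

/-- The composite quadrature values: `w n j` stands for the functional `B(t_n, t_j, uʲ, ·)`. -/
noncomputable def quadValue (w : ℕ → ℕ → V) (n j : ℕ) : V :=
  if j + 2 ≤ n then (1 / 2 : ℝ) • (w n j + w n (j + 1)) else w n (n - 1)

/-- The memory term of the scheme: implicit in the first step, explicit afterwards. -/
noncomputable def memoryTerm (t : ℕ → ℝ) (w : ℕ → ℕ → V) (n : ℕ) : V :=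
  if n = 1 then timeStep t 1 • w 1 1
  else ∑ j ∈ Finset.Icc 1 (n - 1), timeStep t (j + 1) • quadValue w n j

theorem norm_half_smul_add_le {x y : V} {r : ℝ} (hx : ‖x‖ ≤ r) (hy : ‖y‖ ≤ r) :
    ‖(1 / 2 : ℝ) • (x + y)‖ ≤ r := by
  rw [norm_smul, Real.norm_of_nonneg (by norm_num)]
  linarith [norm_add_le x y]

/-- The memory term has increments of order `τ_m`, because the forms are Lipschitz in their first
time argument and the time steps are nondecreasing. -/
theorem norm_memoryTerm_sub_le {t : ℕ → ℝ} (ht : StrictMono t)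
    (hτ : ∀ n, 1 ≤ n → timeStep t n ≤ timeStep t (n + 1)) {N : ℕ} {T K E : ℝ} (hT0 : 0 ≤ T)
    (hT : t N - t 1 ≤ T) (hK : 0 ≤ K) (hE : 0 ≤ E) {w : ℕ → ℕ → V} {u : ℕ → V}
    (hw : ∀ n j, 1 ≤ j → j ≤ n → n ≤ N → ‖w n j‖ ≤ K * ‖u j‖)
    (hw' : ∀ n j, 1 ≤ j → j + 1 ≤ n → n ≤ N → ‖w n j - w (n - 1) j‖ ≤ K * timeStep t n * ‖u j‖)
    {m : ℕ} (hm : 2 ≤ m) (hmN : m ≤ N) (hu : ∀ j, 1 ≤ j → j < m → ‖u j‖ ≤ E) :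
    ‖memoryTerm t w m - memoryTerm t w (m - 1)‖ ≤ K * (T + 3) * timeStep t m * E := by
  have hτpos : ∀ n, 1 ≤ n → 0 < timeStep t n := fun n hn => sub_pos.2 (ht (by omega))
  have hwE : ∀ n j, 1 ≤ j → j < m → j ≤ n → n ≤ N → ‖w n j‖ ≤ K * E := fun n j h1 h2 h3 h4 =>
    (hw n j h1 h3 h4).trans (by gcongr; exact hu j h1 h2)
  have hwE' : ∀ j, 1 ≤ j → j + 1 < m → ‖w m j - w (m - 1) j‖ ≤ K * timeStep t m * E :=
    fun j h1 h2 => (hw' m j h1 h2.le hmN).trans (by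
      have := (hτpos m (by omega)).le
      gcongr
      exact hu j h1 (by omega))
  rcases hm.eq_or_lt with rfl | hm3
  · have h1 := hwE 2 1 le_rfl (by omega) (by omega) hmN
    have h2 := hwE 1 1 le_rfl (by omega) (by omega) (by omega)
    have hs := hτ 1 le_rfl
    have hp := hτpos 1 le_rfl
    have hp2 := hτpos 2 (by omega)
    have e1 : memoryTerm t w 2 = timeStep t 2 • w 2 1 := by simp [memoryTerm, quadValue]
    have e2 : memoryTerm t w (2 - 1) = timeStep t 1 • w 1 1 := by simp [memoryTerm]
    rw [e1, e2]
    refine (norm_sub_le _ _).trans ?_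
    rw [norm_smul, norm_smul, Real.norm_of_nonneg hp.le, Real.norm_of_nonneg hp2.le]
    calc timeStep t 2 * ‖w 2 1‖ + timeStep t 1 * ‖w 1 1‖
        ≤ timeStep t 2 * (K * E) + timeStep t 2 * (K * E) := by gcongr
      _ ≤ K * (T + 3) * timeStep t 2 * E := by
        have : 0 ≤ timeStep t 2 * (K * E) := by positivity
        nlinarith
  · obtain ⟨p, rfl⟩ := Nat.exists_eq_add_of_le' hm3.le
    -- now `m = p + 2` with `p ≥ 1`
    have hτm := hτpos (p + 2) (by omega)
    have e1 : memoryTerm t w (p + 2)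
        = ∑ j ∈ Finset.Icc 1 p, timeStep t (j + 1) • quadValue w (p + 2) j
          + timeStep t (p + 2) • w (p + 2) (p + 1) := by
      rw [memoryTerm, if_neg (by omega), show p + 2 - 1 = p + 1 by omega,
        Finset.sum_Icc_succ_top (by omega)]
      simp [quadValue]
    have e2 : memoryTerm t w (p + 2 - 1)
        = ∑ j ∈ Finset.Icc 1 p, timeStep t (j + 1) • quadValue w (p + 1) j := by
      rw [memoryTerm, if_neg (by omega)]
      simp
    rw [e1, e2, add_sub_right_comm, ← Finset.sum_sub_distrib]
    -- all increments are small except the one where the quadrature rule changes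
    have hterm : ∀ j ∈ Finset.Icc 1 p,
        ‖timeStep t (j + 1) • quadValue w (p + 2) j - timeStep t (j + 1) • quadValue w (p + 1) j‖
          ≤ timeStep t (j + 1) * (K * timeStep t (p + 2) * E)
            + if j = p then timeStep t (p + 2) * (2 * (K * E)) else 0 := by
      intro j hj
      obtain ⟨hj1, hjp⟩ := Finset.mem_Icc.1 hj
      have hτj := hτpos (j + 1) (by omega)
      rw [← smul_sub, norm_smul, Real.norm_of_nonneg hτj.le]
      rcases hjp.eq_or_lt with rfl | hlt
      · rw [if_pos rfl]
        have h1 : ‖quadValue w (j + 2) j‖ ≤ K * E := by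
          rw [quadValue, if_pos le_rfl]
          exact norm_half_smul_add_le (hwE _ _ hj1 (by omega) (by omega) hmN)
            (hwE _ _ (by omega) (by omega) (by omega) hmN)
        have h2 : ‖quadValue w (j + 1) j‖ ≤ K * E := by
          rw [quadValue, if_neg (by omega)]
          exact hwE _ _ (by omega) (by omega) (by omega) (by omega)
        have h3 : timeStep t (j + 1) * ‖quadValue w (j + 2) j - quadValue w (j + 1) j‖
            ≤ timeStep t (j + 2) * (2 * (K * E)) := by
          gcongr
          · exact hτ (j + 1) (by omega)
          · linarith [norm_sub_le (quadValue w (j + 2) j) (quadValue w (j + 1) j)]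
        have h4 : 0 ≤ timeStep t (j + 1) * (K * timeStep t (j + 2) * E) := by positivity
        linarith
      · rw [if_neg hlt.ne, add_zero]
        gcongr
        rw [quadValue, quadValue, if_pos (by omega), if_pos (by omega), ← smul_sub,
          add_sub_add_comm]
        exact norm_half_smul_add_le (hwE' j hj1 (by omega)) (hwE' (j + 1) (by omega) (by omega))
    have hlast : ‖timeStep t (p + 2) • w (p + 2) (p + 1)‖ ≤ timeStep t (p + 2) * (K * E) := by
      rw [norm_smul, Real.norm_of_nonneg hτm.le]
      gcongr
      exact hwE _ _ (by omega) (by omega) (by omega) hmN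
    have hsum := (norm_sum_le _ _).trans (Finset.sum_le_sum hterm)
    rw [Finset.sum_add_distrib, ← Finset.sum_mul, sum_timeStep_succ, Finset.sum_ite_eq',
      if_pos (Finset.mem_Icc.2 ⟨by omega, le_rfl⟩)] at hsum
    have hTp : t (p + 1) - t 1 ≤ T := by
      have := ht.monotone (show p + 1 ≤ N by omega)
      linarith
    have h5 : (t (p + 1) - t 1) * (K * timeStep t (p + 2) * E)
        ≤ T * (K * timeStep t (p + 2) * E) := by gcongr
    refine (norm_add_le _ _).trans ?_
    linarith

/-- Discrete Gronwall inequality, with an implicit first step that is absorbed. -/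
theorem le_exp_of_gronwall {t : ℕ → ℝ} (ht : StrictMono t) {N : ℕ} {F L : ℝ} (hF : 0 ≤ F)
    (hL : 0 ≤ L) (ht0 : 0 ≤ t 0) {a d : ℕ → ℝ}
    (ha : ∀ n, 1 ≤ n → n ≤ N → a n ≤ F + ∑ m ∈ Finset.Icc 1 n, d m) (hd1 : d 1 ≤ a 1 / 2)
    (hd : ∀ m, 2 ≤ m → m ≤ N → ∀ E, 0 ≤ E → (∀ j, 1 ≤ j → j < m → a j ≤ E) →
      d m ≤ L * timeStep t m * E) :
    ∀ n, 1 ≤ n → n ≤ N → a n ≤ 2 * F * Real.exp (L * t n) := by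
  have ht1 : ∀ n, 0 ≤ t n := fun n => ht0.trans (ht.monotone (Nat.zero_le n))
  intro n
  induction n using Nat.strong_induction_on with
  | _ n ih =>
    intro h1 hn
    have ha1 : a 1 ≤ 2 * F := by
      have := ha 1 le_rfl (by omega)
      simp only [Finset.Icc_self, Finset.sum_singleton] at this
      linarith
    have hsum : ∀ p, 1 ≤ p → p ≤ n →
        ∑ m ∈ Finset.Icc 1 p, d m ≤ F + 2 * F * (Real.exp (L * t p) - 1) := by
      intro p hp
      induction p, hp using Nat.le_induction with
      | base =>
        intro _
        have := Real.one_le_exp (mul_nonneg hL (ht1 1))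
        have := mul_nonneg (mul_nonneg zero_le_two hF) (sub_nonneg.2 this)
        simp only [Finset.Icc_self, Finset.sum_singleton]
        linarith
      | succ p hp ihp =>
        intro hpn
        rw [Finset.sum_Icc_succ_top (by omega)]
        have h2 := hd (p + 1) (by omega) (by omega) (2 * F * Real.exp (L * t p)) (by positivity)
          fun j hj1 hjp => (ih j (by omega) hj1 (by omega)).trans (by
            gcongr
            exact ht.monotone (by omega))
        have h3 := ihp (by omega)
        -- `h e^x ≤ e^{x+h} - e^x`
        have h4 : L * timeStep t (p + 1) * Real.exp (L * t p)
            ≤ Real.exp (L * t (p + 1)) - Real.exp (L * t p) := by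
          have h5 := Real.add_one_le_exp (L * timeStep t (p + 1))
          have h6 : Real.exp (L * t (p + 1))
              = Real.exp (L * t p) * Real.exp (L * timeStep t (p + 1)) := by
            rw [← Real.exp_add]
            congr 1
            simp only [timeStep, Nat.add_sub_cancel]
            ring
          rw [h6]
          nlinarith [Real.exp_pos (L * t p)]
        nlinarith [mul_le_mul_of_nonneg_left h4 hF]
    have := ha n h1 hn
    have := hsum n h1 le_rfl
    linarith

/-- Stability of the scheme in an abstract pair of Hilbert spaces. The exponential factor is the
discrete Gronwall constant, and `T ^ (-α) / Γ(1 - α)` is a lower bound for the L1 weights. -/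
theorem norm_le_of_scheme [FiniteDimensional ℝ V] {H : Type*} [NormedAddCommGroup H]
    [InnerProductSpace ℝ H] [CompleteSpace H] (J : V →ₗ[ℝ] H) {α : ℝ} (hα : α ∈ Ioo (0 : ℝ) 1)
    {t : ℕ → ℝ} (ht : StrictMono t) (hτ : ∀ n, 1 ≤ n → timeStep t n ≤ timeStep t (n + 1))
    {N : ℕ} {T K m₀ F : ℝ} (hT : 0 < T) (ht0 : t 0 = 0) (htN : t N = T) (hK : 0 < K)
    (hm₀ : 0 < m₀) (hτ1 : timeStep t 1 ≤ m₀ / (2 * K)) {M : ℕ → ℝ} {w : ℕ → ℕ → V} {u : ℕ → V}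
    {φ : ℕ → H} (hM : ∀ n, 1 ≤ n → n ≤ N → m₀ ≤ M n)
    (hw : ∀ n j, 1 ≤ j → j ≤ n → n ≤ N → ‖w n j‖ ≤ K * ‖u j‖)
    (hw' : ∀ n j, 1 ≤ j → j + 1 ≤ n → n ≤ N → ‖w n j - w (n - 1) j‖ ≤ K * timeStep t n * ‖u j‖)
    (heq : ∀ n, 1 ≤ n → n ≤ N → ∀ v,
      inner ℝ (J (l1Derivative α t u n)) (J v) + M n * inner ℝ (u n) v
        = inner ℝ (φ n) (J v) + inner ℝ (memoryTerm t w n) v)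
    (hφ : ∀ n, 1 ≤ n → n ≤ N → ‖φ n‖ ≤ F) {n : ℕ} (hn1 : 1 ≤ n) (hn : n ≤ N) :
    ‖u n‖ ≤ 2 * Real.sqrt (‖u 0‖ ^ 2 + F ^ 2 / (2 * m₀) / (T ^ (-α) / Real.Gamma (1 - α)))
      * Real.exp (K * (T + 3) / m₀ * T) := by
  have hΓ : 0 < Real.Gamma (1 - α) := Real.Gamma_pos_of_pos (by linarith [hα.2])
  have hm0 : memoryTerm t w 0 = 0 := by simp [memoryTerm]
  have hτpos : ∀ n, 1 ≤ n → 0 < timeStep t n := fun n hn => sub_pos.2 (ht (by omega))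
  have hstab : ∀ n, 1 ≤ n → n ≤ N → ‖u n‖ ≤ _ := fun n h1 h2 =>
    norm_le_of_abstract_scheme J (c := l1Weight α t) (N := N) (g := memoryTerm t w) (φ := φ)
      (show 0 < T ^ (-α) / Real.Gamma (1 - α) by positivity) hm₀
      (fun n _ j hj => l1Weight_nonneg hα ht hj)
      (fun n h1 h2 => le_l1Weight_zero hα ht h1 (by linarith [ht.monotone h2])) hM
      (fun n h1 h2 v => by rw [← l1Derivative_eq_pastDiff]; exact heq n h1 h2 v) hm0 hφ h2
  simp only [Finset.mul_sum] at hstab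
  refine (le_exp_of_gronwall ht (L := K * (T + 3) / m₀) (Real.sqrt_nonneg _) (by positivity)
    ht0.ge hstab ?_ (fun m hm hmN E hE hu => ?_) n hn1 hn).trans ?_
  · have h1 : memoryTerm t w 1 = timeStep t 1 • w 1 1 := by simp [memoryTerm]
    have h2 := hw 1 1 le_rfl le_rfl (by omega)
    simp only [Nat.sub_self, hm0, sub_zero, h1, norm_smul, Real.norm_of_nonneg (hτpos 1 le_rfl).le]
    calc m₀⁻¹ * (timeStep t 1 * ‖w 1 1‖) ≤ m₀⁻¹ * (m₀ / (2 * K) * (K * ‖u 1‖)) := by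
          gcongr
      _ = ‖u 1‖ / 2 := by field_simp
  · have h3 := norm_memoryTerm_sub_le ht hτ hT.le (by
      linarith [ht.monotone (Nat.zero_le 1)]) hK.le hE hw hw' hm hmN hu
    calc m₀⁻¹ * ‖memoryTerm t w m - memoryTerm t w (m - 1)‖
        ≤ m₀⁻¹ * (K * (T + 3) * timeStep t m * E) := by gcongr
      _ = K * (T + 3) / m₀ * timeStep t m * E := by ring
  · gcongr
    exact (ht.monotone hn).trans_eq htN

end Memory

variable {d : ℕ} {Ω : TopologicalSpace.Opens (Space d)}

/-! ### Weighted `L²` products -/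

/-- `c` is a measurable weight on `Ω`, bounded by `K`. -/
structure IsBddWeight (Ω : TopologicalSpace.Opens (Space d)) (K : ℝ) (c : Space d → ℝ) : Prop where
  aesm : AEStronglyMeasurable c (volume.restrict (Ω : Set (Space d)))
  bound : ∀ x ∈ Ω, |c x| ≤ K

/-- The weighted inner product `(c f, g)` of `L²(Ω)`. -/
noncomputable def weightedInner (Ω : TopologicalSpace.Opens (Space d)) (c : Space d → ℝ)
    (f g : L2 Ω) : ℝ :=
  ∫ x in (Ω : Set (Space d)), c x * f x * g x

theorem IsBddWeight.ae_bound {K : ℝ} {c : Space d → ℝ} (hc : IsBddWeight Ω K c) :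
    ∀ᵐ x ∂(volume.restrict (Ω : Set (Space d))), |c x| ≤ K := by
  filter_upwards [ae_restrict_mem Ω.isOpen.measurableSet] with x hx using hc.bound x hx

theorem IsBddWeight.mono {K K' : ℝ} {c : Space d → ℝ} (hc : IsBddWeight Ω K c) (h : K ≤ K') :
    IsBddWeight Ω K' c :=
  ⟨hc.aesm, fun x hx => (hc.bound x hx).trans h⟩

theorem IsBddWeight.integrable {K : ℝ} {c : Space d → ℝ} (hc : IsBddWeight Ω K c) (f g : L2 Ω) :
    Integrable (fun x => c x * f x * g x) (volume.restrict (Ω : Set (Space d))) := by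
  have h1 : Integrable (fun x => f x * g x) (volume.restrict (Ω : Set (Space d))) :=
    (Lp.memLp f).integrable_mul (Lp.memLp g)
  simpa only [mul_assoc] using h1.bdd_mul hc.aesm hc.ae_bound

theorem IsBddWeight.memLp_mul {K : ℝ} {c : Space d → ℝ} (hc : IsBddWeight Ω K c) (f : L2 Ω) :
    MemLp (fun x => c x * f x) 2 (volume.restrict (Ω : Set (Space d))) := by
  refine (Lp.memLp f).of_le_mul (c := K) (hc.aesm.mul (Lp.aestronglyMeasurable f)) ?_
  filter_upwards [hc.ae_bound] with x hx
  rw [norm_mul]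
  exact mul_le_mul_of_nonneg_right hx (norm_nonneg _)

theorem IsBddWeight.weightedInner_eq {K : ℝ} {c : Space d → ℝ} (hc : IsBddWeight Ω K c)
    (f g : L2 Ω) : weightedInner Ω c f g = inner ℝ ((hc.memLp_mul f).toLp _) g := by
  rw [L2.inner_def, weightedInner]
  refine integral_congr_ae ?_
  filter_upwards [(hc.memLp_mul f).coeFn_toLp] with x hx
  rw [hx]
  simp [mul_comm]

theorem IsBddWeight.abs_weightedInner_le {K : ℝ} {c : Space d → ℝ} (hc : IsBddWeight Ω K c)
    (f g : L2 Ω) : |weightedInner Ω c f g| ≤ K * ‖f‖ * ‖g‖ := by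
  rw [hc.weightedInner_eq]
  refine (abs_real_inner_le_norm _ _).trans ?_
  gcongr
  refine Lp.norm_le_mul_norm_of_ae_le_mul ?_
  filter_upwards [hc.ae_bound, (hc.memLp_mul f).coeFn_toLp] with x hx h2
  rw [h2, norm_mul]
  exact mul_le_mul_of_nonneg_right hx (norm_nonneg _)

theorem weightedInner_sub {K K' : ℝ} {c c' : Space d → ℝ} (hc : IsBddWeight Ω K c)
    (hc' : IsBddWeight Ω K' c') (f g : L2 Ω) :
    weightedInner Ω c f g - weightedInner Ω c' f g = weightedInner Ω (fun x => c x - c' x) f g := by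
  rw [weightedInner, weightedInner, weightedInner,
    ← integral_sub (hc.integrable f g) (hc'.integrable f g)]
  congr 1 with x
  ring

/-- The `i`-th component of a vector field. -/
noncomputable def coord (i : Fin d) (U : L2Vec Ω) : L2 Ω :=
  (EuclideanSpace.proj i : Space d →L[ℝ] ℝ).compLp U

theorem coord_ae (i : Fin d) (U : L2Vec Ω) :
    ∀ᵐ x ∂(volume.restrict (Ω : Set (Space d))), coord i U x = U x i := by
  filter_upwards [(EuclideanSpace.proj i : Space d →L[ℝ] ℝ).coeFn_compLp U] with x hx
  rw [coord, hx]
  rfl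

theorem norm_coord_le (i : Fin d) (U : L2Vec Ω) : ‖coord i U‖ ≤ ‖U‖ := by
  refine Lp.norm_le_norm_of_ae_le ?_
  filter_upwards [coord_ae i U] with x hx
  rw [hx]
  exact PiLp.norm_apply_le _ _

theorem coord_add (i : Fin d) (U W : L2Vec Ω) : coord i (U + W) = coord i U + coord i W :=
  map_add ((EuclideanSpace.proj i : Space d →L[ℝ] ℝ).compLpL 2
    (volume.restrict (Ω : Set (Space d)))) U W

theorem coord_smul (i : Fin d) (a : ℝ) (U : L2Vec Ω) : coord i (a • U) = a • coord i U :=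
  map_smul ((EuclideanSpace.proj i : Space d →L[ℝ] ℝ).compLpL 2
    (volume.restrict (Ω : Set (Space d)))) a U

/-! ### The memory form -/

section MemoryForm

/-- The form of the memory operator at fixed times, with coefficients given componentwise. -/
noncomputable def coeffForm (Ω : TopologicalSpace.Opens (Space d))
    (a₂ : Fin d → Fin d → Space d → ℝ) (a₁ : Fin d → Space d → ℝ) (a₀ : Space d → ℝ)
    (u v : H1Pair Ω) : ℝ :=
  (∑ i, ∑ j, weightedInner Ω (a₂ i j) (coord j u.snd) (coord i v.snd))
    - (∑ i, weightedInner Ω (a₁ i) u.fst (coord i v.snd)) + weightedInner Ω a₀ u.fst v.fst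

/-- All coefficients are weights bounded by `K`. -/
structure IsBddCoeff (Ω : TopologicalSpace.Opens (Space d)) (K : ℝ)
    (a₂ : Fin d → Fin d → Space d → ℝ) (a₁ : Fin d → Space d → ℝ) (a₀ : Space d → ℝ) : Prop where
  h₂ : ∀ i j, IsBddWeight Ω K (a₂ i j)
  h₁ : ∀ i, IsBddWeight Ω K (a₁ i)
  h₀ : IsBddWeight Ω K a₀

variable {K K' P : ℝ} {a₂ a₂' : Fin d → Fin d → Space d → ℝ} {a₁ a₁' : Fin d → Space d → ℝ}
  {a₀ a₀' : Space d → ℝ}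

theorem IsBddCoeff.abs_coeffForm_le (h : IsBddCoeff Ω K a₂ a₁ a₀) (hK : 0 ≤ K) (hP : 0 ≤ P)
    {u v : H1Pair Ω} (hu : ‖u.fst‖ ≤ P * ‖u.snd‖) (hv : ‖v.fst‖ ≤ P * ‖v.snd‖) :
    |coeffForm Ω a₂ a₁ a₀ u v| ≤ K * (d * d + d * P + P * P) * ‖u.snd‖ * ‖v.snd‖ := by
  have h2 : |∑ i, ∑ j, weightedInner Ω (a₂ i j) (coord j u.snd) (coord i v.snd)|
      ≤ ∑ _i : Fin d, ∑ _j : Fin d, K * ‖u.snd‖ * ‖v.snd‖ := by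
    refine (Finset.abs_sum_le_sum_abs _ _).trans (Finset.sum_le_sum fun i _ => ?_)
    refine (Finset.abs_sum_le_sum_abs _ _).trans (Finset.sum_le_sum fun j _ => ?_)
    refine ((h.h₂ i j).abs_weightedInner_le _ _).trans ?_
    gcongr <;> exact norm_coord_le _ _
  have h1 : |∑ i, weightedInner Ω (a₁ i) u.fst (coord i v.snd)|
      ≤ ∑ _i : Fin d, K * (P * ‖u.snd‖) * ‖v.snd‖ := by
    refine (Finset.abs_sum_le_sum_abs _ _).trans (Finset.sum_le_sum fun i _ => ?_)
    refine ((h.h₁ i).abs_weightedInner_le _ _).trans ?_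
    gcongr
    exact norm_coord_le _ _
  have h0 : |weightedInner Ω a₀ u.fst v.fst| ≤ K * (P * ‖u.snd‖) * (P * ‖v.snd‖) := by
    refine (h.h₀.abs_weightedInner_le _ _).trans ?_
    gcongr
  simp only [Finset.sum_const, Finset.card_univ, Fintype.card_fin, nsmul_eq_mul] at h2 h1
  refine (abs_add_le _ _).trans
    ((add_le_add ((abs_sub _ _).trans (add_le_add h2 h1)) h0).trans_eq ?_)
  ring

theorem IsBddCoeff.coeffForm_add (h : IsBddCoeff Ω K a₂ a₁ a₀) (u v w : H1Pair Ω) :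
    coeffForm Ω a₂ a₁ a₀ u (v + w) = coeffForm Ω a₂ a₁ a₀ u v + coeffForm Ω a₂ a₁ a₀ u w := by
  simp only [coeffForm, (h.h₂ _ _).weightedInner_eq, (h.h₁ _).weightedInner_eq,
    h.h₀.weightedInner_eq, WithLp.add_fst, WithLp.add_snd, coord_add, inner_add_right,
    Finset.sum_add_distrib]
  ring

theorem IsBddCoeff.coeffForm_smul (h : IsBddCoeff Ω K a₂ a₁ a₀) (u v : H1Pair Ω) (r : ℝ) :
    coeffForm Ω a₂ a₁ a₀ u (r • v) = r * coeffForm Ω a₂ a₁ a₀ u v := by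
  simp only [coeffForm, (h.h₂ _ _).weightedInner_eq, (h.h₁ _).weightedInner_eq,
    h.h₀.weightedInner_eq, WithLp.smul_fst, WithLp.smul_snd, coord_smul, inner_smul_right,
    ← Finset.mul_sum]
  ring

theorem coeffForm_sub (h : IsBddCoeff Ω K a₂ a₁ a₀) (h' : IsBddCoeff Ω K' a₂' a₁' a₀')
    (u v : H1Pair Ω) :
    coeffForm Ω a₂ a₁ a₀ u v - coeffForm Ω a₂' a₁' a₀' u v
      = coeffForm Ω (fun i j x => a₂ i j x - a₂' i j x) (fun i x => a₁ i x - a₁' i x)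
        (fun x => a₀ x - a₀' x) u v := by
  simp only [coeffForm, ← weightedInner_sub (h.h₂ _ _) (h'.h₂ _ _),
    ← weightedInner_sub (h.h₁ _) (h'.h₁ _), ← weightedInner_sub h.h₀ h'.h₀,
    Finset.sum_sub_distrib]
  ring

theorem MemoryCoeff.form_eq_coeffForm (b : MemoryCoeff d) {t s : ℝ}
    (h : IsBddCoeff Ω K (fun i j x => b.b₂ x t s i j) (fun i x => b.b₁ x t s i)
      (fun x => b.b₀ x t s)) (u v : H1Pair Ω) :
    b.form Ω t s u v = coeffForm Ω (fun i j x => b.b₂ x t s i j) (fun i x => b.b₁ x t s i)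
      (fun x => b.b₀ x t s) u v := by
  have h2 : ∫ x in (Ω : Set (Space d)), ∑ i, ∑ j, b.b₂ x t s i j * u.snd x j * v.snd x i
      = ∑ i, ∑ j, weightedInner Ω (fun x => b.b₂ x t s i j) (coord j u.snd) (coord i v.snd) := by
    simp only [weightedInner]
    rw [Finset.sum_congr rfl fun i _ =>
        (integral_finsetSum _ fun j _ => (h.h₂ i j).integrable _ _).symm,
      ← integral_finsetSum _ fun i _ => integrable_finsetSum _ fun j _ =>
        (h.h₂ i j).integrable _ _]
    refine integral_congr_ae ?_
    filter_upwards [ae_all_iff.2 fun i => coord_ae i u.snd,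
      ae_all_iff.2 fun i => coord_ae i v.snd] with x h3 h4
    simp only [h3, h4]
  have h1 : ∫ x in (Ω : Set (Space d)), ∑ i, b.b₁ x t s i * u.fst x * v.snd x i
      = ∑ i, weightedInner Ω (fun x => b.b₁ x t s i) u.fst (coord i v.snd) := by
    simp only [weightedInner]
    rw [← integral_finsetSum _ fun i _ => (h.h₁ i).integrable _ _]
    refine integral_congr_ae ?_
    filter_upwards [ae_all_iff.2 fun i => coord_ae i v.snd] with x h4
    simp only [h4]
  rw [MemoryCoeff.form, h2, h1]
  rfl

end MemoryForm

/-- A smooth function on `Ω̄ × [0,T]²` is bounded, and Lipschitz in its first time argument. -/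
theorem exists_isBddWeight (hconv : Convex ℝ (Ω : Set (Space d)))
    (hbdd : Bornology.IsBounded (Ω : Set (Space d))) {T : ℝ} {c : Space d → ℝ → ℝ → ℝ}
    (hc : ContDiffOn ℝ ∞ (fun p : Space d × ℝ × ℝ => c p.1 p.2.1 p.2.2)
      (closure (Ω : Set (Space d)) ×ˢ Icc 0 T ×ˢ Icc 0 T)) :
    ∃ K, 0 ≤ K ∧ ∀ t ∈ Icc 0 T, ∀ s ∈ Icc 0 T, IsBddWeight Ω K (fun x => c x t s) ∧
      ∀ t' ∈ Icc 0 T, IsBddWeight Ω (K * |t - t'|) (fun x => c x t s - c x t' s) := by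
  have hcomp : IsCompact (closure (Ω : Set (Space d)) ×ˢ Icc (0 : ℝ) T ×ˢ Icc (0 : ℝ) T) :=
    hbdd.isCompact_closure.prod (isCompact_Icc.prod isCompact_Icc)
  obtain ⟨L, hL⟩ := hc.exists_lipschitzOnWith (by simp)
    (hconv.closure.prod ((convex_Icc 0 T).prod (convex_Icc 0 T))) hcomp
  obtain ⟨B, hB⟩ := hcomp.exists_bound_of_continuousOn hc.continuousOn
  have haesm : ∀ t ∈ Icc 0 T, ∀ s ∈ Icc 0 T,
      AEStronglyMeasurable (fun x => c x t s) (volume.restrict (Ω : Set (Space d))) := by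
    intro t ht s hs
    have h1 : ContinuousOn (fun x => c x t s) (Ω : Set (Space d)) :=
      hc.continuousOn.comp (f := fun x => (x, t, s)) (by fun_prop)
        fun x hx => ⟨subset_closure hx, ht, hs⟩
    exact h1.aestronglyMeasurable Ω.isOpen.measurableSet
  refine ⟨max B 0 + L, by positivity, fun t ht s hs => ⟨⟨haesm t ht s hs, fun x hx => ?_⟩,
    fun t' ht' => ⟨(haesm t ht s hs).sub (haesm t' ht' s hs), fun x hx => ?_⟩⟩⟩
  · have h1 := hB (x, t, s) ⟨subset_closure hx, ht, hs⟩
    have h2 := le_max_left B 0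
    have h3 : (0 : ℝ) ≤ L := L.2
    rw [Real.norm_eq_abs] at h1
    linarith
  · have h1 := hL.dist_le_mul (x, t, s) ⟨subset_closure hx, ht, hs⟩ (x, t', s)
      ⟨subset_closure hx, ht', hs⟩
    have h2 : dist (x, t, s) (x, t', s) = |t - t'| := by
      simp [Prod.dist_eq, Real.dist_eq]
    rw [h2, Real.dist_eq] at h1
    refine h1.trans ?_
    gcongr
    linarith [le_max_right B 0]

theorem MemoryCoeff.IsAdmissible.exists_isBddCoeff {b : MemoryCoeff d} {T : ℝ}
    (hb : b.IsAdmissible (Ω : Set (Space d)) T) (hconv : Convex ℝ (Ω : Set (Space d)))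
    (hbdd : Bornology.IsBounded (Ω : Set (Space d))) :
    ∃ K, 0 ≤ K ∧ ∀ t ∈ Icc 0 T, ∀ s ∈ Icc 0 T,
      IsBddCoeff Ω K (fun i j x => b.b₂ x t s i j) (fun i x => b.b₁ x t s i)
        (fun x => b.b₀ x t s) ∧
      ∀ t' ∈ Icc 0 T, IsBddCoeff Ω (K * |t - t'|) (fun i j x => b.b₂ x t s i j - b.b₂ x t' s i j)
        (fun i x => b.b₁ x t s i - b.b₁ x t' s i) (fun x => b.b₀ x t s - b.b₀ x t' s) := by
  choose K₂ hK₂ h₂ using fun i j => exists_isBddWeight (T := T)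
    (c := fun x t s => b.b₂ x t s i j) hconv hbdd (hb.smooth₂ i j)
  choose K₁ hK₁ h₁ using fun i => exists_isBddWeight (T := T)
    (c := fun x t s => b.b₁ x t s i) hconv hbdd (hb.smooth₁ i)
  obtain ⟨K₀, hK₀, h₀⟩ := exists_isBddWeight (T := T) (c := b.b₀) hconv hbdd hb.smooth₀
  have s2 : 0 ≤ ∑ i, ∑ j, K₂ i j :=
    Finset.sum_nonneg fun i _ => Finset.sum_nonneg fun j _ => hK₂ i j
  have s1 : 0 ≤ ∑ i, K₁ i := Finset.sum_nonneg fun i _ => hK₁ i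
  have l2 : ∀ i j, K₂ i j ≤ ∑ i, ∑ j, K₂ i j + ∑ i, K₁ i + K₀ := by
    intro i j
    have e1 := Finset.single_le_sum (f := fun j => K₂ i j) (fun j _ => hK₂ i j) (Finset.mem_univ j)
    have e2 := Finset.single_le_sum (f := fun i => ∑ j, K₂ i j)
      (fun i _ => Finset.sum_nonneg fun j _ => hK₂ i j) (Finset.mem_univ i)
    linarith
  have l1 : ∀ i, K₁ i ≤ ∑ i, ∑ j, K₂ i j + ∑ i, K₁ i + K₀ := by
    intro i
    have e1 := Finset.single_le_sum (f := K₁) (fun i _ => hK₁ i) (Finset.mem_univ i)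
    linarith
  have l0 : K₀ ≤ ∑ i, ∑ j, K₂ i j + ∑ i, K₁ i + K₀ := by linarith
  refine ⟨∑ i, ∑ j, K₂ i j + ∑ i, K₁ i + K₀, by linarith, fun t ht s hs =>
    ⟨⟨fun i j => (h₂ i j t ht s hs).1.mono (l2 i j), fun i => (h₁ i t ht s hs).1.mono (l1 i),
      (h₀ t ht s hs).1.mono l0⟩, fun t' ht' => ⟨fun i j => ((h₂ i j t ht s hs).2 t' ht').mono ?_,
      fun i => ((h₁ i t ht s hs).2 t' ht').mono ?_, ((h₀ t ht s hs).2 t' ht').mono ?_⟩⟩⟩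
  · exact mul_le_mul_of_nonneg_right (l2 i j) (abs_nonneg _)
  · exact mul_le_mul_of_nonneg_right (l1 i) (abs_nonneg _)
  · exact mul_le_mul_of_nonneg_right l0 (abs_nonneg _)

/-! ### The space `H¹₀(Ω)` -/

theorem gradient_apply (ψ : Space d → ℝ) (x : Space d) (i : Fin d) :
    gradient ψ x i = fderiv ℝ ψ x (EuclideanSpace.single i 1) := by
  rw [← inner_gradient_left, EuclideanSpace.inner_single_right]
  simp

/-- The weak gradient identity, passed to the limit from test functions. -/
theorem integral_fst_mul_fderiv_of_mem_H10 {p : H1Pair Ω} (hp : p ∈ H10 Ω) {φ : Space d → ℝ}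
    (hφ : ContDiff ℝ ∞ φ) (hφc : HasCompactSupport φ) (i : Fin d) :
    ∫ x in (Ω : Set (Space d)), fderiv ℝ φ x (EuclideanSpace.single i 1) * p.fst x
      = - ∫ x in (Ω : Set (Space d)), φ x * coord i p.snd x := by
  have hd : Continuous fun x => fderiv ℝ φ x (EuclideanSpace.single i 1) :=
    (hφ.continuous_fderiv (by simp)).clm_apply continuous_const
  have hdc : HasCompactSupport fun x => fderiv ℝ φ x (EuclideanSpace.single i 1) :=
    hφc.fderiv_apply (𝕜 := ℝ) _
  have m1 : MemLp (fun x => fderiv ℝ φ x (EuclideanSpace.single i 1)) 2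
      (volume.restrict (Ω : Set (Space d))) := (hd.memLp_of_hasCompactSupport hdc).restrict _
  have m2 : MemLp φ 2 (volume.restrict (Ω : Set (Space d))) :=
    (hφ.continuous.memLp_of_hasCompactSupport hφc).restrict _
  have e1 : ∀ q : L2 Ω, ∫ x in (Ω : Set (Space d)),
      fderiv ℝ φ x (EuclideanSpace.single i 1) * q x = inner ℝ q (m1.toLp _) := by
    intro q
    rw [L2.inner_def]
    refine integral_congr_ae ?_
    filter_upwards [m1.coeFn_toLp] with x hx
    rw [hx]
    simp
  have e2 : ∀ q : L2 Ω, ∫ x in (Ω : Set (Space d)), φ x * q x = inner ℝ q (m2.toLp _) := by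
    intro q
    rw [L2.inner_def]
    refine integral_congr_ae ?_
    filter_upwards [m2.coeFn_toLp] with x hx
    rw [hx]
    simp
  have hcl : IsClosed {q : H1Pair Ω | ∫ x in (Ω : Set (Space d)),
      fderiv ℝ φ x (EuclideanSpace.single i 1) * q.fst x
        = - ∫ x in (Ω : Set (Space d)), φ x * coord i q.snd x} := by
    simp only [e1, e2]
    refine isClosed_eq ?_ ?_
    · exact (WithLp.prod_continuous_ofLp 2 _ _).fst.inner continuous_const
    · refine Continuous.neg (Continuous.inner ?_ continuous_const)
      exact ((EuclideanSpace.proj i : Space d →L[ℝ] ℝ).compLpL 2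
        (volume.restrict (Ω : Set (Space d)))).continuous.comp
          (WithLp.prod_continuous_ofLp 2 _ _).snd
  refine closure_minimal (t := {q : H1Pair Ω | ∫ x in (Ω : Set (Space d)),
      fderiv ℝ φ x (EuclideanSpace.single i 1) * q.fst x
        = - ∫ x in (Ω : Set (Space d)), φ x * coord i q.snd x}) ?_ hcl hp
  rintro q ⟨ψ, h1, h2⟩
  have hψ : ContDiff ℝ ∞ (ψ : Space d → ℝ) := ψ.contDiff
  have hψc : HasCompactSupport (ψ : Space d → ℝ) := ψ.hasCompactSupport
  have hψd : Continuous fun x => fderiv ℝ ψ x (EuclideanSpace.single i 1) :=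
    (hψ.continuous_fderiv (by simp)).clm_apply continuous_const
  have hout : ∀ x, x ∉ (Ω : Set (Space d)) → x ∉ tsupport ψ :=
    fun x hx h => hx (ψ.tsupport_subset h)
  show ∫ x in (Ω : Set (Space d)), fderiv ℝ φ x (EuclideanSpace.single i 1) * q.fst x
        = - ∫ x in (Ω : Set (Space d)), φ x * coord i q.snd x
  have e3 : ∫ x in (Ω : Set (Space d)), fderiv ℝ φ x (EuclideanSpace.single i 1) * q.fst x
      = ∫ x, fderiv ℝ φ x (EuclideanSpace.single i 1) * ψ x := by
    refine Eq.trans (integral_congr_ae ?_)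
      (setIntegral_eq_integral_of_forall_compl_eq_zero (s := (Ω : Set (Space d)))
        fun x hx => by rw [image_eq_zero_of_notMem_tsupport (hout x hx), mul_zero])
    filter_upwards [h1] with x hx
    rw [hx]
  have e4 : ∫ x in (Ω : Set (Space d)), φ x * coord i q.snd x
      = ∫ x, φ x * fderiv ℝ ψ x (EuclideanSpace.single i 1) := by
    refine Eq.trans (integral_congr_ae ?_)
      (setIntegral_eq_integral_of_forall_compl_eq_zero (s := (Ω : Set (Space d)))
        fun x hx => by
          rw [fderiv_of_notMem_tsupport (𝕜 := ℝ) (hout x hx), zero_apply,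
            mul_zero])
    filter_upwards [h2, coord_ae i q.snd] with x hx hx'
    rw [hx', hx, gradient_apply]
  rw [e3, e4, integral_mul_fderiv_eq_neg_fderiv_mul_of_integrable, neg_neg]
  · exact (hd.mul ψ.continuous).integrable_of_hasCompactSupport hdc.mul_right
  · exact (hφ.continuous.mul hψd).integrable_of_hasCompactSupport hφc.mul_right
  · exact (hφ.continuous.mul ψ.continuous).integrable_of_hasCompactSupport hφc.mul_right
  · exact fun x _ => hφ.differentiable (by simp) x
  · exact fun x _ => hψ.differentiable (by simp) x

/-- The gradient on `H¹₀(Ω)` is closable: a pair `(0, g)` in `H¹₀(Ω)` has `g = 0`. -/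
theorem snd_eq_zero_of_mem_H10 {p : H1Pair Ω} (hp : p ∈ H10 Ω) (h0 : p.fst = 0) : p.snd = 0 := by
  have hcoord : ∀ i, ∀ᵐ x ∂(volume.restrict (Ω : Set (Space d))), coord i p.snd x = 0 := by
    intro i
    have hloc : LocallyIntegrableOn (coord i p.snd) (Ω : Set (Space d))
        (volume.restrict (Ω : Set (Space d))) :=
      ((Lp.memLp (coord i p.snd)).locallyIntegrable (by norm_num)).locallyIntegrableOn _
    have h1 := Ω.isOpen.ae_eq_zero_of_integral_contDiff_smul_eq_zero hloc fun φ hφ hφc _ => by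
      have h2 := integral_fst_mul_fderiv_of_mem_H10 hp hφ hφc i
      have h3 : ∫ x in (Ω : Set (Space d)), fderiv ℝ φ x (EuclideanSpace.single i 1) * p.fst x
          = 0 := by
        rw [h0]
        refine integral_eq_zero_of_ae ?_
        filter_upwards [Lp.coeFn_zero ℝ 2 (volume.restrict (Ω : Set (Space d)))] with x hx
        rw [hx]
        simp
      rw [h3] at h2
      simpa using h2.symm
    filter_upwards [h1, ae_restrict_mem Ω.isOpen.measurableSet] with x hx hxΩ using hx hxΩ
  rw [Lp.eq_zero_iff_ae_eq_zero]
  filter_upwards [ae_all_iff.2 hcoord, ae_all_iff.2 fun i => coord_ae i p.snd] with x h1 h2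
  ext i
  rw [← h2, h1]
  rfl

/-- Poincaré's inequality. It follows from `‖u‖² = -2 (x₁ u, ∂₁u)`. -/
theorem exists_poincare (hd : 1 ≤ d) (hbdd : Bornology.IsBounded (Ω : Set (Space d))) :
    ∃ P, 0 ≤ P ∧ ∀ p ∈ H10 Ω, ‖p.fst‖ ≤ P * ‖p.snd‖ := by
  obtain ⟨R, hR⟩ := hbdd.exists_norm_le
  let i : Fin d := ⟨0, hd⟩
  have hw : IsBddWeight Ω (max R 0) fun x => x i :=
    ⟨(by fun_prop : Continuous fun x : Space d => x i).aestronglyMeasurable,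
      fun x hx => ((PiLp.norm_apply_le x i).trans (hR x hx)).trans (le_max_left _ _)⟩
  refine ⟨2 * max R 0, by positivity, fun p hp => ?_⟩
  refine closure_minimal (t := {q : H1Pair Ω | ‖q.fst‖ ≤ 2 * max R 0 * ‖q.snd‖}) ?_ ?_ hp
  · intro q hq
    have hqH : q ∈ H10 Ω := Submodule.le_topologicalClosure _ hq
    obtain ⟨ψ, h1, h2⟩ := hq
    have hψ : ContDiff ℝ ∞ (ψ : Space d → ℝ) := ψ.contDiff
    have hx : ContDiff ℝ ∞ fun x : Space d => x i := by fun_prop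
    have h3 := integral_fst_mul_fderiv_of_mem_H10 hqH (φ := fun x => x i * ψ x) (hx.mul hψ)
      ψ.hasCompactSupport.mul_left i
    have hder : ∀ x, fderiv ℝ (fun x : Space d => x i * ψ x) x (EuclideanSpace.single i 1)
        = x i * fderiv ℝ ψ x (EuclideanSpace.single i 1) + ψ x := by
      intro x
      have hp : HasFDerivAt (fun x : Space d => x i)
          (EuclideanSpace.proj i : Space d →L[ℝ] ℝ) x :=
        (EuclideanSpace.proj i : Space d →L[ℝ] ℝ).hasFDerivAt
      have he := (hp.mul (hψ.differentiable (by simp) x).hasFDerivAt).fderiv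
      change fderiv ℝ (fun x : Space d => x i * ψ x) x = _ at he
      rw [he]
      simp
    have e1 : ∫ x in (Ω : Set (Space d)),
        fderiv ℝ (fun x : Space d => x i * ψ x) x (EuclideanSpace.single i 1) * q.fst x
          = weightedInner Ω (fun x => x i) q.fst (coord i q.snd) + inner ℝ q.fst q.fst := by
      rw [L2.inner_def, weightedInner, ← integral_add (hw.integrable _ _) (L2.integrable_inner _ _)]
      refine integral_congr_ae ?_
      filter_upwards [h1, h2, coord_ae i q.snd] with x hx1 hx2 hx3
      rw [hder, hx3, hx2, hx1, gradient_apply]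
      simp
      ring
    have e2 : ∫ x in (Ω : Set (Space d)), (x i * ψ x) * coord i q.snd x
        = weightedInner Ω (fun x => x i) q.fst (coord i q.snd) := by
      refine integral_congr_ae ?_
      filter_upwards [h1] with x hx1
      rw [hx1]
    rw [e1, e2, real_inner_self_eq_norm_sq] at h3
    have h4 := hw.abs_weightedInner_le q.fst (coord i q.snd)
    have h5 : max R 0 * ‖q.fst‖ * ‖coord i q.snd‖ ≤ max R 0 * ‖q.fst‖ * ‖q.snd‖ := by
      gcongr
      exact norm_coord_le i q.snd
    have h6 := (abs_le.1 h4).1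
    show ‖q.fst‖ ≤ 2 * max R 0 * ‖q.snd‖
    rcases (norm_nonneg q.fst).eq_or_lt with h7 | h7
    · rw [← h7]
      positivity
    · nlinarith
  · refine isClosed_le ?_ ?_
    · exact (WithLp.prod_continuous_ofLp 2 _ _).fst.norm
    · exact continuous_const.mul (WithLp.prod_continuous_ofLp 2 _ _).snd.norm

/-! ### The finite element space is finite-dimensional -/

theorem memLp_affine (μ : Measure (Space d)) [IsLocallyFiniteMeasure μ] {s : Set (Space d)}
    (hs : IsCompact s) (a : (Space d →L[ℝ] ℝ) × ℝ) :
    MemLp (fun x => a.1 x + a.2) 2 (μ.restrict s) := by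
  have hc : Continuous fun x => a.1 x + a.2 := by fun_prop
  obtain ⟨B, hB⟩ := hs.exists_bound_of_continuousOn hc.continuousOn
  have : IsFiniteMeasure (μ.restrict s) := ⟨by simpa using hs.measure_lt_top⟩
  refine MemLp.of_bound hc.aestronglyMeasurable B ?_
  filter_upwards [ae_restrict_mem hs.measurableSet] with x hx using hB x hx

/-- The affine functions on a compact set `s`, as a linear map from their parameters to `L²(s)`. -/
noncomputable def affineL2 (μ : Measure (Space d)) [IsLocallyFiniteMeasure μ] {s : Set (Space d)}
    (hs : IsCompact s) : (Space d →L[ℝ] ℝ) × ℝ →ₗ[ℝ] Lp ℝ 2 (μ.restrict s) where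
  toFun a := (memLp_affine μ hs a).toLp _
  map_add' a a' := by
    rw [← MemLp.toLp_add]
    congr 1 with x
    simp
    ring
  map_smul' r a := by
    rw [RingHom.id_apply, ← MemLp.toLp_const_smul]
    congr 1 with x
    simp
    ring

theorem finiteDimensional_femSpace {𝒯 : Geometry.SimplicialComplex ℝ (Space d)}
    (h𝒯 : IsTriangulation (Ω : Set (Space d)) 𝒯) : FiniteDimensional ℝ (femSpace Ω 𝒯) := by
  let ι : Type := {S : Finset (Space d) // S ∈ 𝒯.faces ∧ S.card = d + 1}
  have : Finite ι := (h𝒯.finite.subset fun S hS => hS.1 :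
    {S | S ∈ 𝒯.faces ∧ S.card = d + 1}.Finite).to_subtype
  have hcomp : ∀ S : ι, IsCompact (convexHull ℝ (S.1 : Set (Space d))) := fun S =>
    S.1.finite_toSet.isCompact_convexHull ℝ
  let μ : Measure (Space d) := volume.restrict (Ω : Set (Space d))
  -- the restriction of an element of `X_h` to one simplex
  let r : ∀ S : ι, femSpace Ω 𝒯 →ₗ[ℝ] Lp ℝ 2 (μ.restrict (convexHull ℝ (S.1 : Set (Space d)))) :=
    fun S =>
      (LpToLpRestrictCLM (Space d) ℝ ℝ μ 2 (convexHull ℝ (S.1 : Set (Space d)))).toLinearMap ∘ₗ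
      WithLp.fstₗ 2 ℝ (L2 Ω) (L2Vec Ω) ∘ₗ (femSpace Ω 𝒯).subtype
  have hr : ∀ S v, r S v =ᵐ[μ.restrict (convexHull ℝ (S.1 : Set (Space d)))] v.1.fst := fun S v =>
    LpToLpRestrictCLM_coeFn ℝ _ _
  have hmem : ∀ S v, r S v ∈ LinearMap.range (affineL2 μ (hcomp S)) := by
    intro S v
    obtain ⟨a, ha⟩ := v.2.2.1 S.1 S.2.1 S.2.2
    refine ⟨(LinearMap.toContinuousLinearMap a.linear, a 0), ?_⟩
    refine Lp.ext ((memLp_affine μ (hcomp S) (_, _)).coeFn_toLp.trans ?_)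
    filter_upwards [hr S v, ae_restrict_of_ae ha, ae_restrict_mem (hcomp S).measurableSet]
      with x h1 h2 h3
    rw [h1, h2 h3]
    have := a.map_vadd 0 x
    simpa using this.symm
  let R : femSpace Ω 𝒯 →ₗ[ℝ] ∀ S : ι, LinearMap.range (affineL2 μ (hcomp S)) :=
    LinearMap.pi fun S => (r S).codRestrict _ (hmem S)
  have hinj : Function.Injective R := by
    rw [← LinearMap.ker_eq_bot, LinearMap.ker_eq_bot']
    intro v hv
    have hv0 : ∀ S, r S v = 0 := fun S => congrArg Subtype.val (congrFun hv S)
    have h1 : ∀ᵐ x ∂μ, ∀ S : ι, x ∈ convexHull ℝ (S.1 : Set (Space d)) → v.1.fst x = 0 := by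
      rw [ae_all_iff]
      intro S
      rw [← ae_restrict_iff' (hcomp S).measurableSet]
      have h2 := hr S v
      rw [hv0] at h2
      filter_upwards [h2, Lp.coeFn_zero ℝ 2 (μ.restrict (convexHull ℝ (S.1 : Set (Space d))))]
        with x h3 h4
      rw [← h3, h4]
      rfl
    have hfst : v.1.fst = 0 := by
      rw [Lp.eq_zero_iff_ae_eq_zero]
      filter_upwards [h1, v.2.2.2] with x h3 h4
      by_cases hx : x ∈ 𝒯.space
      · obtain ⟨s, hs, hxs⟩ := Geometry.SimplicialComplex.mem_space_iff.1 hx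
        obtain ⟨S, hS, hsS, hc⟩ := h𝒯.pure s hs
        exact h3 ⟨S, hS, hc⟩ (convexHull_mono (Finset.coe_subset.2 hsS) hxs)
      · exact h4 hx
    have hsnd := snd_eq_zero_of_mem_H10 v.2.1 hfst
    exact Subtype.ext ((WithLp.ofLp_injective 2) (Prod.ext hfst hsnd))
  exact Module.Finite.of_injective R hinj

/-! ### Stability of the fully discrete scheme -/

theorem l1Derivative_congr {V : Type*} [AddCommGroup V] [Module ℝ V] (α : ℝ) (t : ℕ → ℝ)
    {v w : ℕ → V} {n : ℕ} (h : ∀ j ≤ n, v j = w j) :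
    l1Derivative α t v n = l1Derivative α t w n := by
  rw [l1Derivative_eq_pastDiff, l1Derivative_eq_pastDiff, pastDiff_congr h]

theorem map_l1Derivative {V W : Type*} [AddCommGroup V] [Module ℝ V] [AddCommGroup W] [Module ℝ W]
    (L : V →ₗ[ℝ] W) (α : ℝ) (t : ℕ → ℝ) (v : ℕ → V) (n : ℕ) :
    L (l1Derivative α t v n) = l1Derivative α t (fun j => L (v j)) n := by
  rw [l1Derivative_eq_pastDiff, l1Derivative_eq_pastDiff, map_pastDiff]

/-- The Ritz projection does not increase the gradient norm. -/
theorem IsRitzProjection.norm_snd_le {X : Submodule ℝ (H1Pair Ω)} {w p : H1Pair Ω}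
    (h : IsRitzProjection X w p) : ‖p.snd‖ ≤ ‖w.snd‖ := by
  have h1 := h.2 p h.1
  have h2 := real_inner_le_norm w.snd p.snd
  rw [← h1, real_inner_self_eq_norm_sq] at h2
  rcases (norm_nonneg p.snd).eq_or_lt with h3 | h3
  · rw [← h3]
    exact norm_nonneg _
  · nlinarith

/-- The lower bound on `M`, extended to `0` by continuity. -/
theorem le_of_lipschitzOnWith {M : ℝ → ℝ} {L : ℝ≥0} {m₀ : ℝ} (hL : LipschitzOnWith L M (Ici 0))
    (hM : ∀ s > 0, m₀ ≤ M s) {s : ℝ} (hs : 0 ≤ s) : m₀ ≤ M s := by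
  rcases hs.eq_or_lt with rfl | hs
  · have h1 : Filter.Tendsto M (𝓝[>] 0) (𝓝 (M 0)) :=
      (hL.continuousOn 0 self_mem_Ici).mono_left (nhdsWithin_mono _ Ioi_subset_Ici_self)
    refine ge_of_tendsto h1 ?_
    filter_upwards [self_mem_nhdsWithin] with x hx using hM x hx
  · exact hM s hs

/-- Stability of the scheme in any finite-dimensional subspace `X` on which Poincaré's inequality
holds. The gradients of the elements of `X` form a Hilbert space `V` whose inner product is that of
`H¹₀`; `J : V → L²` recovers the function from its gradient. -/
theorem IsDiscreteSolution.norm_snd_le {X : Submodule ℝ (H1Pair Ω)} [FiniteDimensional ℝ X]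
    {α T m₀ K₀ P : ℝ} (hα : α ∈ Ioo (0 : ℝ) 1) (hT : 0 < T) (hm₀ : 0 < m₀) (hK₀ : 0 ≤ K₀)
    (hP : 0 ≤ P) (hX : ∀ v ∈ X, ‖v.fst‖ ≤ P * ‖v.snd‖) {b : MemoryCoeff d}
    (hb : ∀ t ∈ Icc 0 T, ∀ s ∈ Icc 0 T,
      IsBddCoeff Ω K₀ (fun i j x => b.b₂ x t s i j) (fun i x => b.b₁ x t s i)
        (fun x => b.b₀ x t s) ∧
      ∀ t' ∈ Icc 0 T, IsBddCoeff Ω (K₀ * |t - t'|)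
        (fun i j x => b.b₂ x t s i j - b.b₂ x t' s i j)
        (fun i x => b.b₁ x t s i - b.b₁ x t' s i) (fun x => b.b₀ x t s - b.b₀ x t' s))
    {M : ℝ → ℝ} (hM : ∀ s, 0 ≤ s → m₀ ≤ M s) {t : ℕ → ℝ} (ht : StrictMono t)
    (hτ : ∀ n, 1 ≤ n → timeStep t n ≤ timeStep t (n + 1)) {N : ℕ} (ht0 : t 0 = 0) (htN : t N = T)
    {K : ℝ} (hK : 0 < K) (hKK : K₀ * (d * d + d * P + P * P) ≤ K)
    (hτ1 : timeStep t 1 ≤ m₀ / (2 * K)) {u₀ : H1Pair Ω} {f : ℕ → L2 Ω} {u : ℕ → H1Pair Ω}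
    (hu : IsDiscreteSolution Ω X α M b t N u₀ f u) {F : ℝ}
    (hf : ∀ n, 1 ≤ n → n ≤ N → ‖f n‖ ≤ F) {n : ℕ} (hn1 : 1 ≤ n) (hn : n ≤ N) :
    ‖(u n).snd‖ ≤ 2 * Real.sqrt (‖u₀.snd‖ ^ 2 + F ^ 2 / (2 * m₀) / (T ^ (-α) / Real.Gamma (1 - α)))
      * Real.exp (K * (T + 3) / m₀ * T) := by
  classical
  have huX : ∀ j ≤ N, u j ∈ X := fun j hj => by
    rcases Nat.eq_zero_or_pos j with rfl | hpos
    · exact hu.initial.1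
    · exact hu.mem j hpos hj
  have htI : ∀ j ≤ N, t j ∈ Icc 0 T := fun j hj =>
    ⟨ht0 ▸ ht.monotone (Nat.zero_le j), htN ▸ ht.monotone hj⟩
  let G : X →ₗ[ℝ] L2Vec Ω := WithLp.sndₗ 2 ℝ (L2 Ω) (L2Vec Ω) ∘ₗ X.subtype
  have hG : Function.Injective G := by
    rw [← LinearMap.ker_eq_bot, LinearMap.ker_eq_bot']
    intro v hv
    have hsnd : v.1.snd = 0 := hv
    have h1 := hX v.1 v.2
    rw [hsnd, norm_zero, mul_zero] at h1
    exact Subtype.ext ((WithLp.ofLp_injective 2) (Prod.ext (norm_le_zero_iff.1 h1) hsnd))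
  let V : Submodule ℝ (L2Vec Ω) := LinearMap.range G
  let e : X ≃ₗ[ℝ] V := LinearEquiv.ofInjective G hG
  let J : V →ₗ[ℝ] L2 Ω := WithLp.fstₗ 2 ℝ (L2 Ω) (L2Vec Ω) ∘ₗ X.subtype ∘ₗ e.symm.toLinearMap
  have hsnd : ∀ v : V, (e.symm v).1.snd = v := fun v =>
    congrArg Subtype.val (e.apply_symm_apply v)
  -- the numerical solution as a sequence in `V`
  let y : ℕ → V := fun j => if h : u j ∈ X then e ⟨u j, h⟩ else 0
  have hy : ∀ j ≤ N, (e.symm (y j) : H1Pair Ω) = u j := by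
    intro j hj
    simp only [y, dif_pos (huX j hj), LinearEquiv.symm_apply_apply]
  have hynorm : ∀ j ≤ N, ‖y j‖ = ‖(u j).snd‖ := by
    intro j hj
    rw [← hy j hj, hsnd]
    rfl
  have hform : ∀ p ≤ N, ∀ j ≤ N, ∀ v ∈ X,
      |b.form Ω (t p) (t j) (u j) v| ≤ K * ‖(u j).snd‖ * ‖v.snd‖ := by
    intro p hp j hj v hv
    have hbc := (hb _ (htI p hp) _ (htI j hj)).1
    rw [b.form_eq_coeffForm hbc]
    refine (hbc.abs_coeffForm_le hK₀ hP (hX _ (huX j hj)) (hX v hv)).trans ?_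
    gcongr
  have hformdiff : ∀ p ≤ N, ∀ q ≤ N, ∀ j ≤ N, ∀ v ∈ X,
      |b.form Ω (t p) (t j) (u j) v - b.form Ω (t q) (t j) (u j) v|
        ≤ K * |t p - t q| * ‖(u j).snd‖ * ‖v.snd‖ := by
    intro p hp q hq j hj v hv
    have hbc := hb _ (htI p hp) _ (htI j hj)
    have hbc' := (hb _ (htI q hq) _ (htI j hj)).1
    rw [b.form_eq_coeffForm hbc.1, b.form_eq_coeffForm hbc', coeffForm_sub hbc.1 hbc']
    refine ((hbc.2 _ (htI q hq)).abs_coeffForm_le (by positivity) hP (hX _ (huX j hj))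
      (hX v hv)).trans ?_
    rw [mul_right_comm K₀]
    gcongr
  -- Riesz representation of the functionals `B(t_p, t_j, uʲ, ·)` in `V`
  have hriesz : ∀ p j, ∃ w : V, p ≤ N → j ≤ N → ∀ v : V,
      inner ℝ w v = b.form Ω (t p) (t j) (u j) (e.symm v) := by
    intro p j
    by_cases h : p ≤ N ∧ j ≤ N
    · have hbc := (hb _ (htI p h.1) _ (htI j h.2)).1
      let ℓ : V →ₗ[ℝ] ℝ :=
        { toFun := fun v => b.form Ω (t p) (t j) (u j) (e.symm v)
          map_add' := fun v v' => by
            simp only [b.form_eq_coeffForm hbc, map_add, Submodule.coe_add, hbc.coeffForm_add]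
          map_smul' := fun r v => by
            simp only [b.form_eq_coeffForm hbc, map_smul, Submodule.coe_smul, hbc.coeffForm_smul,
              RingHom.id_apply, smul_eq_mul] }
      have : CompleteSpace V := FiniteDimensional.complete ℝ V
      refine ⟨(InnerProductSpace.toDual ℝ V).symm (LinearMap.toContinuousLinearMap ℓ),
        fun _ _ v => ?_⟩
      rw [InnerProductSpace.toDual_symm_apply]
      rfl
    · exact ⟨0, fun h1 h2 => absurd ⟨h1, h2⟩ h⟩
  choose w hw using hriesz
  have hnorm_le : ∀ (x : V) (r : ℝ), 0 ≤ r → |inner ℝ x x| ≤ r * ‖x‖ → ‖x‖ ≤ r := by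
    intro x r hr h
    rw [real_inner_self_eq_norm_sq, abs_of_nonneg (sq_nonneg _)] at h
    rcases (norm_nonneg x).eq_or_lt with h3 | h3
    · rwa [← h3]
    · nlinarith
  have hsndnorm : ∀ v : V, ‖(e.symm v).1.snd‖ = ‖v‖ := fun v => by rw [hsnd]; rfl
  have hwb : ∀ p j, 1 ≤ j → j ≤ p → p ≤ N → ‖w p j‖ ≤ K * ‖y j‖ := by
    intro p j _ hjp hp
    refine hnorm_le _ _ (by positivity) ?_
    rw [hw p j hp (hjp.trans hp), hynorm j (hjp.trans hp), ← hsndnorm (w p j)]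
    exact hform p hp j (hjp.trans hp) _ (e.symm (w p j)).2
  have hwd : ∀ p j, 1 ≤ j → j + 1 ≤ p → p ≤ N →
      ‖w p j - w (p - 1) j‖ ≤ K * timeStep t p * ‖y j‖ := by
    intro p j _ hjp hp
    have hτp : 0 ≤ timeStep t p := sub_nonneg.2 (ht.monotone (Nat.sub_le p 1))
    refine hnorm_le _ _ (by positivity) ?_
    rw [inner_sub_left (w p j), hw p j hp (by omega), hw (p - 1) j (by omega) (by omega),
      hynorm j (by omega), ← hsndnorm (w p j - w (p - 1) j)]
    have h1 := hformdiff p hp (p - 1) (by omega) j (by omega) _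
      (e.symm (w p j - w (p - 1) j)).2
    rwa [show |t p - t (p - 1)| = timeStep t p from abs_of_nonneg hτp] at h1
  have hJ : ∀ p ≤ N, (l1Derivative α t u p).fst = J (l1Derivative α t y p) := by
    intro p hp
    rw [map_l1Derivative]
    have h1 := map_l1Derivative (WithLp.fstₗ 2 ℝ (L2 Ω) (L2Vec Ω)) α t u p
    refine h1.trans (l1Derivative_congr α t fun j hj => ?_)
    rw [← hy j (hj.trans hp)]
    rfl
  let Mn : ℕ → ℝ := fun p =>
    if p = 1 then M (‖(u 1).snd‖ ^ 2) else M (‖(extrapolate t u p).snd‖ ^ 2)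
  have hMn : ∀ p, 1 ≤ p → p ≤ N → m₀ ≤ Mn p := by
    intro p _ _
    simp only [Mn]
    split_ifs <;> exact hM _ (sq_nonneg _)
  have hinner : ∀ p ≤ N, ∀ v : V, inner ℝ (u p).snd (e.symm v).1.snd = inner ℝ (y p) v := by
    intro p hp v
    rw [← hy p hp, hsnd, hsnd]
    rfl
  have heq : ∀ p, 1 ≤ p → p ≤ N → ∀ v : V,
      inner ℝ (J (l1Derivative α t y p)) (J v) + Mn p * inner ℝ (y p) v
        = inner ℝ (f p) (J v) + inner ℝ (memoryTerm t w p) v := by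
    intro p hp1 hp v
    rw [← hJ p hp, ← hinner p hp]
    rcases hp1.eq_or_lt with rfl | hp2
    · obtain ⟨fh, hfh, h1⟩ := hu.first
      have h2 := h1 _ (e.symm v).2
      rw [hfh.2 _ (e.symm v).2] at h2
      simp only [Mn, memoryTerm, if_true, inner_smul_left]
      rw [hw 1 1 hp hp]
      exact h2
    · obtain ⟨fh, hfh, h1⟩ := hu.step p hp2 hp
      have h2 := h1 _ (e.symm v).2
      rw [hfh.2 _ (e.symm v).2] at h2
      have hp' : p ≠ 1 := by omega
      simp only [Mn, memoryTerm, if_neg hp', sum_inner, inner_smul_left]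
      refine h2.trans ?_
      congr 1
      refine Finset.sum_congr rfl fun j hj => ?_
      obtain ⟨hj1, hjp⟩ := Finset.mem_Icc.1 hj
      congr 1
      rw [memoryBar, quadValue]
      split_ifs with h3
      · rw [inner_smul_left, inner_add_left, hw p j hp (by omega), hw p (j + 1) hp (by omega)]
        rfl
      · rw [hw p (p - 1) hp (by omega)]
  have hmain := norm_le_of_scheme J hα ht hτ hT ht0 htN hK hm₀ hτ1 hMn hwb hwd heq hf hn1 hn
  rw [hynorm n hn, hynorm 0 (Nat.zero_le N)] at hmain
  refine hmain.trans ?_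
  have hΓ : 0 < Real.Gamma (1 - α) := Real.Gamma_pos_of_pos (by linarith [hα.2])
  gcongr
  exact hu.initial.norm_snd_le

end Kirchhoff

theorem mainTheorem9 (d : ℕ) (hd : 1 ≤ d)
    (Ω : TopologicalSpace.Opens (Kirchhoff.Space d))
    (hΩne : (Ω : Set (Kirchhoff.Space d)).Nonempty)
    (hΩconv : Convex ℝ (Ω : Set (Kirchhoff.Space d)))
    (hΩbdd : Bornology.IsBounded (Ω : Set (Kirchhoff.Space d)))
    (hΩsmooth : Kirchhoff.HasSmoothBoundary (Ω : Set (Kirchhoff.Space d)))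
    (T : ℝ) (hT : 0 < T) (α : ℝ) (hα : α ∈ Ioo (0 : ℝ) 1)
    (b : Kirchhoff.MemoryCoeff d) (hb : b.IsAdmissible (Ω : Set (Kirchhoff.Space d)) T)
    (m₀ : ℝ) (hm₀ : 0 < m₀) (σ κ : ℝ) :
    ∃ C > 0, ∃ τ₀ > 0,
      ∀ (M : ℝ → ℝ) (L : ℝ≥0) (u₀ : Kirchhoff.H1Pair Ω) (f : ℝ → Kirchhoff.L2 Ω),
        LipschitzOnWith L M (Ici 0) →
        u₀ ∈ Kirchhoff.H10 Ω → Kirchhoff.MemH2 Ω u₀ →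
        MemLp f ⊤ (volume.restrict (Ioo 0 T)) →
        (∀ s > 0, m₀ ≤ M s) →
        0 < m₀ - 4 * L * (‖u₀‖ + (eLpNorm f ⊤ (volume.restrict (Ioo 0 T))).toReal) ^ 2 →
      ∀ 𝒯 : Geometry.SimplicialComplex ℝ (Kirchhoff.Space d),
        Kirchhoff.IsTriangulation (Ω : Set (Kirchhoff.Space d)) 𝒯 →
        Kirchhoff.IsShapeRegular σ 𝒯 → Kirchhoff.IsQuasiUniform κ 𝒯 →
      ∀ (δ : ℝ) (N : ℕ) (_ : 1 ≤ δ) (hN : 1 ≤ N),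
        Kirchhoff.timeStep (Kirchhoff.gridTime T δ N) 1 ≤ τ₀ →
      ∀ u : ℕ → Kirchhoff.H1Pair Ω,
        Kirchhoff.IsDiscreteSolution Ω (Kirchhoff.femSpace Ω 𝒯) α M b
          (Kirchhoff.gridTime T δ N) N u₀ (fun n => f (Kirchhoff.gridTime T δ N n)) u →
        (Finset.Icc 1 N).sup' (Finset.nonempty_Icc.2 hN) (fun n => ‖(u n).snd‖)
          ≤ C * (‖u₀.snd‖ + (Finset.Icc 1 N).sup' (Finset.nonempty_Icc.2 hN)
              (fun n => ‖f (Kirchhoff.gridTime T δ N n)‖)) := by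
  obtain ⟨P, hP, hpoin⟩ := Kirchhoff.exists_poincare hd hΩbdd
  obtain ⟨K₀, hK₀, hcoef⟩ := hb.exists_isBddCoeff hΩconv hΩbdd
  set K : ℝ := K₀ * (d * d + d * P + P * P) + 1 with hKdef
  have hK : 0 < K := by positivity
  have hΓ : 0 < Real.Gamma (1 - α) := Real.Gamma_pos_of_pos (by linarith [hα.2])
  set c : ℝ := 1 / (2 * m₀) / (T ^ (-α) / Real.Gamma (1 - α)) with hc
  have hc0 : 0 < c := by positivity
  refine ⟨2 * (1 + Real.sqrt c) * Real.exp (K * (T + 3) / m₀ * T), by positivity,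
    m₀ / (2 * K), by positivity, ?_⟩
  intro M L u₀ f hL _ _ _ hM _ 𝒯 h𝒯 _ _ δ N hδ hN hτ1 u hu
  have : FiniteDimensional ℝ (Kirchhoff.femSpace Ω 𝒯) := Kirchhoff.finiteDimensional_femSpace h𝒯
  set F := (Finset.Icc 1 N).sup' (Finset.nonempty_Icc.2 hN)
    (fun n => ‖f (Kirchhoff.gridTime T δ N n)‖) with hFdef
  have hf : ∀ n, 1 ≤ n → n ≤ N → ‖f (Kirchhoff.gridTime T δ N n)‖ ≤ F := fun n h1 h2 =>
    Finset.le_sup' (fun n => ‖f (Kirchhoff.gridTime T δ N n)‖) (Finset.mem_Icc.2 ⟨h1, h2⟩)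
  have hF : 0 ≤ F := (norm_nonneg _).trans (hf 1 le_rfl hN)
  refine Finset.sup'_le _ _ fun n hn => ?_
  obtain ⟨hn1, hnN⟩ := Finset.mem_Icc.1 hn
  refine (Kirchhoff.IsDiscreteSolution.norm_snd_le (X := Kirchhoff.femSpace Ω 𝒯) hα hT hm₀ hK₀ hP
    (fun v hv => hpoin v hv.1) hcoef
    (fun s hs => Kirchhoff.le_of_lipschitzOnWith hL hM hs)
    (Kirchhoff.strictMono_gridTime hT hδ hN)
    (fun n h => Kirchhoff.timeStep_gridTime_le_succ hT hδ N h) (Kirchhoff.gridTime_zero T hδ N)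
    (Kirchhoff.gridTime_self T δ hN) hK (by rw [hKdef]; linarith) hτ1 hu hf hn1 hnN).trans ?_
  have hsqrt : Real.sqrt (‖u₀.snd‖ ^ 2 + F ^ 2 / (2 * m₀) / (T ^ (-α) / Real.Gamma (1 - α)))
      ≤ (1 + Real.sqrt c) * (‖u₀.snd‖ + F) := by
    have h1 : F ^ 2 / (2 * m₀) / (T ^ (-α) / Real.Gamma (1 - α)) = c * F ^ 2 := by
      rw [hc]
      ring
    rw [h1]
    refine Real.sqrt_le_iff.2 ⟨by positivity, ?_⟩
    have h2 := Real.sq_sqrt hc0.le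
    have h3 := Real.sqrt_nonneg c
    have h4 := norm_nonneg u₀.snd
    calc ‖u₀.snd‖ ^ 2 + c * F ^ 2 ≤ (‖u₀.snd‖ + Real.sqrt c * F) ^ 2 := by
          nlinarith [mul_nonneg h4 (mul_nonneg h3 hF)]
      _ ≤ ((1 + Real.sqrt c) * (‖u₀.snd‖ + F)) ^ 2 := by
          refine pow_le_pow_left₀ (by positivity) ?_ 2
          nlinarith [mul_nonneg h3 h4]
  calc 2 * Real.sqrt (‖u₀.snd‖ ^ 2 + F ^ 2 / (2 * m₀) / (T ^ (-α) / Real.Gamma (1 - α)))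
        * Real.exp (K * (T + 3) / m₀ * T)
      ≤ 2 * ((1 + Real.sqrt c) * (‖u₀.snd‖ + F)) * Real.exp (K * (T + 3) / m₀ * T) := by gcongr
    _ = _ := by ring
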